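/- Let $G$ be a finite connected graph, possibly with multiple edges and loops, in which every vertex has degree $6$ (each loop contributing $2$ to the degree of its vertex) and whose number of vertices is odd. Then $G$ has a rooted decomposition into three odd closed trails: there are a vertex $v$ of $G$ and three subgraphs $G_1,G_2,G_3$ of $G$ whose edge sets partition $E(G)$ such that each $G_i$ contains $v$ and consists of the vertices and edges of a closed trail of odd length. Here a closed trail is an alternating sequence $v_0e_1v_1e_2\dots e_kv_k$ of vertices and edges with $v_0=v_k$ in which each $e_j$ joins $v_{j-1}$ to $v_j$ and the edges $e_1,\dots,e_k$ are pairwise distinct (vertices may be repeated); its length is $k$. -/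

import Mathlib

open scoped Graph

namespace Graph

variable {α β : Type*}

/-- The degree of a vertex of a multigraph with finitely many edges: the number of incident
edges, where a loop is counted twice. -/
noncomputable def loopDegree (G : Graph α β) (x : α) : ℕ :=
  {e | G.IsNonloopAt e x}.ncard + 2 * {e | G.IsLoopAt e x}.ncard

/-- All vertices have degree `d`. -/
def IsRegularOfDeg (G : Graph α β) (d : ℕ) : Prop :=
  ∀ x ∈ V(G), G.loopDegree x = d

/-- `G.IsWalkOn u [(e₁, v₁), …, (eₖ, vₖ)] w` says that `u e₁ v₁ e₂ v₂ … eₖ vₖ` is a walk in `G`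
with last vertex `w`. -/
def IsWalkOn (G : Graph α β) : α → List (β × α) → α → Prop
  | u, [], w => u ∈ V(G) ∧ u = w
  | u, (e, v) :: l, w => G.IsLink e u v ∧ G.IsWalkOn v l w

/-- A graph is connected if it has a vertex and any two vertices are joined by a walk. -/
def IsConn (G : Graph α β) : Prop :=
  V(G).Nonempty ∧ ∀ x ∈ V(G), ∀ y ∈ V(G), ∃ l, G.IsWalkOn x l y

/-- A closed trail `u e₁ v₁ … eₖ vₖ`, `vₖ = u`: a walk with distinct edges that returns to its
initial vertex (vertices may be repeated). -/
def IsClosedTrailOn (G : Graph α β) (u : α) (l : List (β × α)) : Prop :=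
  G.IsWalkOn u l u ∧ (l.map Prod.fst).Nodup

/-- The graph `H` is a closed trail of odd length: some closed trail of odd length in `H`
has exactly the edges and the vertices of `H`. -/
def IsOddClosedTrail (H : Graph α β) : Prop :=
  ∃ (u : α) (l : List (β × α)), H.IsClosedTrailOn u l ∧ Odd l.length ∧
    (∀ e, e ∈ E(H) ↔ e ∈ l.map Prod.fst) ∧ (∀ x, x ∈ V(H) ↔ x ∈ u :: l.map Prod.snd)

/-- `H 0, …, H (k - 1)` is a decomposition of `G` into `k` closed trails of odd length
with root `v`: the `H i` are subgraphs of `G` whose edge sets partition the edge set of `G`,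
each is a closed trail of odd length, and each contains the vertex `v`. -/
structure IsRootedOddDecomposition (G : Graph α β) {k : ℕ} (H : Fin k → Graph α β) (v : α) :
    Prop where
  le : ∀ i, H i ≤ G
  disjoint : ∀ i j, i ≠ j → Disjoint E(H i) E(H j)
  cover : (⋃ i, E(H i)) = E(G)
  oddClosedTrail : ∀ i, (H i).IsOddClosedTrail
  root_mem : ∀ i, v ∈ V(H i)

end Graph

set_option linter.unusedSectionVars false

/-! Call every edge of G odd. Splitting off replaces edges xu, uy by an edge xy whose sign is the
sum of the two signs. Each edge of the resulting signed multigraph stands for a walk of that parity,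
and together the walks use every edge of G exactly once. So it suffices to find a root v and to
split at the other vertices until only three odd loops at v remain (`Reducible`).

The obstructions are labellings s of the vertices by -1, 0, 1 with s v = 1. An edge xy of sign a
costs |s x - (-1)^a s y|. By the triangle inequality splitting never raises the total cost, and
three odd loops at v cost 6, so every such labelling must cost at least 6. A suitable root exists
because of the odd number of vertices: 6|∑ s| is at most the cost, so a labelling cheaper than 6 has
label sum 0 and a support of even size. If each vertex lay in the support of such a labelling,
uncrossing would make the supports disjoint, and the number of vertices would be even
(`IsOddSixRegular.not_cover`). Cuts of two edges are removed beforehand (`exists_red_of_two_cut`).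

These conditions suffice (`IsRooted.reducible`), by induction on the sum of the degrees off the
root. If a nontrivial labelling costs 6, switching turns it into the indicator of a set U. Contract
U to v and apply induction; what then remains inside U is a flow problem, in which only 0/1
labellings matter (`reducible_of_tight_set`, `red_to_root`).

If every nontrivial labelling costs at least 8 (`IsStrict`), some splitting at a neighbour u of v
keeps all conditions (`exists_red_of_isStrict`). Otherwise each splitting is obstructed by a
labelling or a small cut, and submodularity plays these against each other. The surviving case has
two labellings that are opposite off v. Then cuts of size at least 4 force all labels except that of
u to be nonzero (`ne_zero_of_opposite`), and the parity of half the cost contradicts the odd total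
sign (`cost_eq_two_mul`). -/

namespace SignedGraph

/-! ### Labels, signed edges and costs -/

/-- An edge of a signed multigraph: its pair of ends together with its sign, `1` meaning odd. -/
abbrev SEdge (V : Type*) := Sym2 V × ZMod 2

/-- The action of a sign on a label. -/
def act (a : ZMod 2) (p : SignType) : SignType := if a = 0 then p else -p

/-- The distance between two labels on the line `-1, 0, 1`. -/
def gap (p q : SignType) : ℕ := if p = q then 0 else if p = -q then 2 else 1

/-- The part of two labels on which they agree. -/
def meet (p q : SignType) : SignType := if p = q then p else 0

/-- The sign of the sum of two labels. -/
def join (p q : SignType) : SignType :=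
  if p = 0 then q else if q = 0 then p else if p = q then p else 0

/-- The label `p`, erased if it equals the label `r • q`. -/
def rem (r p q : SignType) : SignType := if p = r * q then 0 else p

theorem act_zero (p : SignType) : act 0 p = p := by simp [act]

theorem act_self_zero : ∀ a, act a 0 = 0 := by decide

theorem act_add : ∀ a b p, act (a + b) p = act a (act b p) := by decide

theorem gap_act : ∀ a p q, gap p (act a q) = gap q (act a p) := by decide

theorem gap_act_act : ∀ a p q, gap (act a p) (act a q) = gap p q := by decide

theorem gap_triangle : ∀ p q r, gap p q ≤ gap p r + gap r q := by decide

/-- Submodularity for a single edge, the source of all uncrossing of labellings. -/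
theorem gap_meet_join : ∀ a p q p' q', gap (meet p p') (act a (meet q q'))
    + gap (join p p') (act a (join q q')) ≤ gap p (act a q) + gap p' (act a q') := by decide

/-- The posimodular companion: labels are erased where the two labellings agree up to the sign r,
which serves to make supports disjoint. -/
theorem gap_rem : ∀ r a p q p' q', r ≠ 0 → gap (rem r p p') (act a (rem r q q'))
    + gap (rem r p' p) (act a (rem r q' q)) ≤ gap p (act a q) + gap p' (act a q') := by decide

theorem act_meet : ∀ a p q, act a (meet p q) = meet (act a p) (act a q) := by decide

theorem act_join : ∀ a p q, act a (join p q) = join (act a p) (act a q) := by decide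

variable {V V' : Type*} [DecidableEq V] [DecidableEq V']

/-- The cost of an edge with respect to a labelling of the vertices. -/
def cost (s : V → SignType) (e : SEdge V) : ℕ :=
  Sym2.lift ⟨fun x y => gap (s x) (act e.2 (s y)), fun _ _ => gap_act _ _ _⟩ e.1

/-- The indicator function of the set of edges leaving `Z`. -/
def cut (Z : Finset V) (e : SEdge V) : ℕ :=
  Sym2.lift ⟨fun x y => if (x ∈ Z ↔ y ∈ Z) then 0 else 1, fun x y => by simp only [iff_comm]⟩ e.1

/-- The number of ends of an edge that are equal to `u`. -/
def deg (u : V) (e : SEdge V) : ℕ :=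
  Sym2.lift ⟨fun x y => (if x = u then 1 else 0) + (if y = u then 1 else 0),
    fun _ _ => add_comm _ _⟩ e.1

@[simp] theorem cost_mk (s : V → SignType) (x y : V) (a : ZMod 2) :
    cost s (s(x, y), a) = gap (s x) (act a (s y)) := rfl

@[simp] theorem cut_mk (Z : Finset V) (x y : V) (a : ZMod 2) :
    cut Z (s(x, y), a) = if (x ∈ Z ↔ y ∈ Z) then 0 else 1 := rfl

@[simp] theorem deg_mk (u x y : V) (a : ZMod 2) :
    deg u (s(x, y), a) = (if x = u then 1 else 0) + (if y = u then 1 else 0) := rfl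

/-- The total weight of a multiset of edges. -/
def wt {ε A : Type*} [AddCommMonoid A] (f : ε → A) (M : Multiset ε) : A := (M.map f).sum

section wt
variable {ε A : Type*} [AddCommMonoid A] (f g : ε → A) (M N : Multiset ε) (e : ε)

@[simp] theorem wt_zero : wt f (0 : Multiset ε) = 0 := by simp [wt]
@[simp] theorem wt_cons : wt f (e ::ₘ M) = f e + wt f M := by simp [wt]
@[simp] theorem wt_add : wt f (M + N) = wt f M + wt f N := by simp [wt]
theorem wt_map {δ : Type*} (π : δ → ε) (M : Multiset δ) : wt f (M.map π) = wt (f ∘ π) M := by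
  simp [wt]
theorem wt_fun_add : wt (fun e => f e + g e) M = wt f M + wt g M := by simp [wt]
theorem wt_congr {f g : ε → A} {M : Multiset ε} (h : ∀ e ∈ M, f e = g e) : wt f M = wt g M := by
  rw [wt, wt, Multiset.map_congr rfl h]
theorem wt_univ {ι : Type*} [Fintype ι] (e : ι → ε) :
    wt f (Finset.univ.val.map e) = ∑ i, f (e i) := by
  rw [wt, Multiset.map_map]; rfl
end wt

theorem wt_le {ε : Type*} {f g : ε → ℕ} {M : Multiset ε} (h : ∀ e ∈ M, f e ≤ g e) :
    wt f M ≤ wt g M := Multiset.sum_map_le_sum_map f g h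

theorem le_wt {ε : Type*} (f : ε → ℕ) {M : Multiset ε} {e : ε} (h : e ∈ M) : f e ≤ wt f M := by
  obtain ⟨R, rfl⟩ := Multiset.exists_cons_of_mem h
  simp

theorem wt_eq_zero {ε : Type*} {f : ε → ℕ} {M : Multiset ε} :
    wt f M = 0 ↔ ∀ e ∈ M, f e = 0 := by
  simp [wt, Multiset.sum_eq_zero_iff]

/-! ### Splitting off -/

/-- The labelling that is `1` on `W` and `0` elsewhere. -/
def ind (W : Finset V) (x : V) : SignType := if x ∈ W then 1 else 0

/-- `Step S M N`: the signed multigraph `N` arises from `M` by splitting off a pair of edges at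
a vertex outside `S`. -/
def Step (S : Finset V) (M N : Multiset (SEdge V)) : Prop :=
  ∃ u x y a b R, u ∉ S ∧ M = (s(x, u), a) ::ₘ (s(u, y), b) ::ₘ R ∧ N = (s(x, y), a + b) ::ₘ R

/-- Iterated splitting off at vertices outside `S`. -/
def Red (S : Finset V) : Multiset (SEdge V) → Multiset (SEdge V) → Prop :=
  Relation.ReflTransGen (Step S)

theorem Step.mono {S S' : Finset V} (h : S ⊆ S') {M N : Multiset (SEdge V)} (H : Step S' M N) :
    Step S M N := by
  obtain ⟨u, x, y, a, b, R, hu, h1, h2⟩ := H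
  exact ⟨u, x, y, a, b, R, fun h' => hu (h h'), h1, h2⟩

theorem Red.mono {S S' : Finset V} (h : S ⊆ S') {M N : Multiset (SEdge V)} (H : Red S' M N) :
    Red S M N := Relation.ReflTransGen.mono (fun _ _ => Step.mono h) _ _ H

theorem Step.cost_le {S : Finset V} {M N : Multiset (SEdge V)} (H : Step S M N)
    (s : V → SignType) : wt (cost s) N ≤ wt (cost s) M := by
  obtain ⟨u, x, y, a, b, R, hu, rfl, rfl⟩ := H
  simp only [wt_cons, cost_mk]
  have := gap_triangle (s x) (act (a + b) (s y)) (act a (s u))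
  rw [act_add, gap_act_act] at this
  rw [act_add]; omega

/-- An indicator that vanishes at u loses cost only if both outer ends lie in the set and the new
edge is even. If this happens for W, it happens for the larger S, so the loss for W is at most the
loss for S. -/
theorem Step.cost_ind_le {S W : Finset V} (hW : W ⊆ S) {M N : Multiset (SEdge V)}
    (H : Step S M N) :
    wt (cost (ind W)) M + wt (cost (ind S)) N ≤ wt (cost (ind W)) N + wt (cost (ind S)) M := by
  obtain ⟨u, x, y, a, b, R, hu, rfl, rfl⟩ := H
  have huW : u ∉ W := fun h => hu (hW h)
  have key : ∀ a b p p' q q', (p = 1 → p' = 1) → (q = 1 → q' = 1) → p ≠ -1 → q ≠ -1 →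
      p' ≠ -1 → q' ≠ -1 →
      gap p (act a 0) + gap 0 (act b q) + gap p' (act (a + b) q') ≤
      gap p (act (a + b) q) + gap p' (act a 0) + gap 0 (act b q') := by decide
  have hm : ∀ z, ind W z = 1 → ind S z = 1 := by
    intro z; unfold ind; split_ifs with h1 h2 <;> simp; exact h2 (hW h1)
  have hn : ∀ (W : Finset V) z, ind W z ≠ -1 := by
    intro W z; unfold ind; split_ifs <;> decide
  have := key a b _ _ _ _ (hm x) (hm y) (hn _ _) (hn _ _) (hn _ _) (hn _ _)
  have h1 : ind W u = 0 := by simp [ind, huW]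
  have h2 : ind S u = 0 := by simp [ind, hu]
  simp only [wt_cons, cost_mk, h1, h2]
  omega

theorem Step.deg_eq {S : Finset V} {M N : Multiset (SEdge V)} (H : Step S M N) {w : V}
    (hw : w ∈ S) : wt (deg w) N = wt (deg w) M := by
  obtain ⟨u, x, y, a, b, R, hu, rfl, rfl⟩ := H
  have : u ≠ w := by rintro rfl; exact hu hw
  simp [this]; omega

theorem Step.deg_le {S : Finset V} {M N : Multiset (SEdge V)} (H : Step S M N) (w : V) :
    wt (deg w) N ≤ wt (deg w) M := by
  obtain ⟨u, x, y, a, b, R, hu, rfl, rfl⟩ := H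
  simp; omega

theorem Step.even_deg {S : Finset V} {M N : Multiset (SEdge V)} (H : Step S M N) {w : V}
    (hw : Even (wt (deg w) M)) : Even (wt (deg w) N) := by
  obtain ⟨u, x, y, a, b, R, hu, rfl, rfl⟩ := H
  simp only [wt_cons, deg_mk] at *
  split_ifs at * <;> simp [Nat.even_add, parity_simps] at * <;> tauto

theorem Step.sign_eq {S : Finset V} {M N : Multiset (SEdge V)} (H : Step S M N) :
    wt Prod.snd N = wt Prod.snd M := by
  obtain ⟨u, x, y, a, b, R, hu, rfl, rfl⟩ := H
  simp [add_assoc]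

/-- Both removed edges meet a vertex outside S, so edges inside S survive. -/
theorem Step.filter_le {S : Finset V} {M N : Multiset (SEdge V)} (H : Step S M N) :
    M.filter (fun e => e.1 ∈ S.sym2) ≤ N.filter (fun e => e.1 ∈ S.sym2) := by
  obtain ⟨u, x, y, a, b, R, hu, rfl, rfl⟩ := H
  rw [Multiset.filter_cons_of_neg, Multiset.filter_cons_of_neg]
  · exact Multiset.filter_le_filter _ (Multiset.le_cons_self _ _)
  · simp [hu]
  · simp [hu]

section Red
variable {S : Finset V} {M N : Multiset (SEdge V)}

theorem Red.cost_le (H : Red S M N) (s : V → SignType) :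
    wt (cost s) N ≤ wt (cost s) M := by
  induction H with
  | refl => rfl
  | tail _ h ih => exact (h.cost_le s).trans ih

theorem Red.cost_ind_le {W : Finset V} (hW : W ⊆ S) (H : Red S M N) :
    wt (cost (ind W)) M + wt (cost (ind S)) N ≤ wt (cost (ind W)) N + wt (cost (ind S)) M := by
  induction H with
  | refl => rfl
  | tail _ h ih => have := h.cost_ind_le hW; omega

theorem Red.deg_eq (H : Red S M N) {w : V} (hw : w ∈ S) : wt (deg w) N = wt (deg w) M := by
  induction H with
  | refl => rfl
  | tail _ h ih => exact (h.deg_eq hw).trans ih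

theorem Red.deg_le (H : Red S M N) (w : V) : wt (deg w) N ≤ wt (deg w) M := by
  induction H with
  | refl => rfl
  | tail _ h ih => exact (h.deg_le w).trans ih

theorem Red.even_deg (H : Red S M N) {w : V} (hw : Even (wt (deg w) M)) :
    Even (wt (deg w) N) := by
  induction H with
  | refl => exact hw
  | tail _ h ih => exact h.even_deg ih

theorem Red.sign_eq (H : Red S M N) : wt Prod.snd N = wt Prod.snd M := by
  induction H with
  | refl => rfl
  | tail _ h ih => exact h.sign_eq.trans ih

theorem Red.filter_le (H : Red S M N) :
    M.filter (fun e => e.1 ∈ S.sym2) ≤ N.filter (fun e => e.1 ∈ S.sym2) := by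
  induction H with
  | refl => rfl
  | tail _ h ih => exact ih.trans h.filter_le

end Red

/-! ### Contraction and switching -/

/-- The image of an edge under a map of the vertices. -/
def emap (π : V → V') (e : SEdge V) : SEdge V' := (e.1.map π, e.2)

@[simp] theorem emap_mk (π : V → V') (x y : V) (a : ZMod 2) :
    emap π (s(x, y), a) = (s(π x, π y), a) := rfl

/-- Splittings lift along a contraction that is injective outside `S`. -/
theorem Red.lift {S' : Finset V'} {S : Finset V} (π : V → V')
    (hπ : ∀ x y, π x ∉ S' → π x = π y → x = y) (hS : ∀ x, π x ∉ S' → x ∉ S)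
    {M : Multiset (SEdge V)} {N' : Multiset (SEdge V')} (H : Red S' (M.map (emap π)) N') :
    ∃ N, Red S M N ∧ N.map (emap π) = N' := by
  induction H with
  | refl => exact ⟨M, .refl, rfl⟩
  | @tail P' Q' _ h ih =>
    obtain ⟨P, hP, rfl⟩ := ih
    obtain ⟨u, x, y, a, b, R, hu, h1, rfl⟩ := h
    obtain ⟨e, he, hee, hR⟩ := (Multiset.map_eq_cons _ _ _ _).2 h1
    obtain ⟨f, hf, hff, hR'⟩ := (Multiset.map_eq_cons _ _ _ _).2 hR
    have orient : ∀ (e : SEdge V) (x' u' : V') (a : ZMod 2), emap π e = (s(x', u'), a) →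
        ∃ x u, π x = x' ∧ π u = u' ∧ e = (s(x, u), a) := by
      rintro ⟨e, b⟩ x' u' a
      induction e with | _ p q
      rw [emap_mk, Prod.mk.injEq, Sym2.eq_iff]
      rintro ⟨⟨rfl, rfl⟩ | ⟨rfl, rfl⟩, rfl⟩
      · exact ⟨p, q, rfl, rfl, rfl⟩
      · exact ⟨q, p, rfl, rfl, by rw [Sym2.eq_swap]⟩
    obtain ⟨x₁, u₁, rfl, rfl, rfl⟩ := orient _ _ _ _ hee
    obtain ⟨u₂, y₁, h2, rfl, rfl⟩ := orient _ _ _ _ hff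
    obtain rfl := hπ _ _ hu h2.symm
    refine ⟨(s(x₁, y₁), a + b) ::ₘ (P.erase (s(x₁, u₁), a)).erase (s(u₁, y₁), b),
      hP.tail ⟨u₁, x₁, y₁, a, b, _, hS _ hu, ?_, rfl⟩, by simp [hR']⟩
    rw [Multiset.cons_erase hf, Multiset.cons_erase he]

/-- Switching an edge. -/
def sw (f : V → ZMod 2) (e : SEdge V) : SEdge V :=
  (e.1, e.2 + Sym2.lift ⟨fun x y => f x + f y, fun _ _ => add_comm _ _⟩ e.1)

@[simp] theorem sw_mk (f : V → ZMod 2) (x y : V) (a : ZMod 2) :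
    sw f (s(x, y), a) = (s(x, y), a + (f x + f y)) := rfl

theorem sw_sw (f : V → ZMod 2) (e : SEdge V) : sw f (sw f e) = e := by
  obtain ⟨e, a⟩ := e
  induction e with | _ p q
  simp only [sw_mk, Prod.mk.injEq, true_and]
  rw [add_assoc, CharTwo.add_self_eq_zero, add_zero]

theorem Red.switch {S : Finset V} (f : V → ZMod 2) {M N : Multiset (SEdge V)}
    (H : Red S M N) : Red S (M.map (sw f)) (N.map (sw f)) := by
  induction H with
  | refl => exact .refl
  | tail _ h ih =>
    refine ih.tail ?_
    obtain ⟨u, x, y, a, b, R, hu, rfl, rfl⟩ := h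
    refine ⟨u, x, y, a + (f x + f u), b + (f u + f y), R.map (sw f), hu, by simp, ?_⟩
    simp only [Multiset.map_cons, sw_mk]
    congr 2
    linear_combination (norm := ring_nf) - CharTwo.add_self_eq_zero (f u)

theorem cost_sw (f : V → ZMod 2) (s : V → SignType) (e : SEdge V) :
    cost s (sw f e) = cost (fun x => act (f x) (s x)) e := by
  obtain ⟨e, a⟩ := e
  induction e with | _ p q
  have : ∀ a b c p q, gap p (act (a + (b + c)) q) = gap (act b p) (act a (act c q)) := by decide
  simp [this]

theorem wt_lift_eq_sum {A : Type*} [CommSemiring A] [Fintype V] (f : V → A)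
    (M : Multiset (SEdge V)) :
    wt (fun e : SEdge V => Sym2.lift ⟨fun x y => f x + f y, fun _ _ => add_comm _ _⟩ e.1) M
      = ∑ w, (wt (deg w) M : ℕ) * f w := by
  induction M using Multiset.induction_on with
  | empty => simp
  | cons e M ih =>
    obtain ⟨e, a⟩ := e
    induction e with | _ p q
    simp [ih, add_mul, Finset.sum_add_distrib]

/-- The value f w enters once per edge end at w, hence an even number of times. -/
theorem sign_sw [Fintype V] (f : V → ZMod 2) {M : Multiset (SEdge V)}
    (hM : ∀ w, Even (wt (deg w) M)) : wt Prod.snd (M.map (sw f)) = wt Prod.snd M := by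
  have h : wt Prod.snd (M.map (sw f)) = wt Prod.snd M +
      wt (fun e : SEdge V => Sym2.lift ⟨fun x y => f x + f y, fun _ _ => add_comm _ _⟩ e.1) M := by
    rw [wt_map, ← wt_fun_add]; rfl
  rw [h, wt_lift_eq_sum, Finset.sum_eq_zero, add_zero]
  intro w _
  rw [(ZMod.natCast_eq_zero_iff_even).2 (hM w), zero_mul]

/-- The total cost is even when all degrees are. -/
theorem even_cost [Fintype V] (s : V → SignType) {M : Multiset (SEdge V)}
    (hM : ∀ w, Even (wt (deg w) M)) : Even (wt (cost s) M) := by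
  -- The cost of an edge is odd exactly when one of its ends has label 0 and the other does not.
  let f : V → ZMod 2 := fun x => if s x = 0 then 0 else 1
  have h : ((wt (cost s) M : ℕ) : ZMod 2) =
      wt (fun e : SEdge V => Sym2.lift ⟨fun x y => f x + f y, fun _ _ => add_comm _ _⟩ e.1) M := by
    clear hM
    induction M using Multiset.induction_on with
    | empty => simp
    | cons e M ih =>
      obtain ⟨e, a⟩ := e
      induction e with | _ p q
      have : ∀ a p q, ((gap p (act a q) : ℕ) : ZMod 2) =
        (if p = 0 then 0 else 1) + (if q = 0 then 0 else 1) := by decide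
      simp [ih, this, f]
  rw [← ZMod.natCast_eq_zero_iff_even, h, wt_lift_eq_sum, Finset.sum_eq_zero]
  intro w _
  rw [(ZMod.natCast_eq_zero_iff_even).2 (hM w), zero_mul]

theorem even_cut [Fintype V] (Z : Finset V) {M : Multiset (SEdge V)}
    (hM : ∀ w, Even (wt (deg w) M)) : Even (wt (cut Z) M) := by
  let f : V → ZMod 2 := fun x => if x ∈ Z then 1 else 0
  have h : ((wt (cut Z) M : ℕ) : ZMod 2) =
      wt (fun e : SEdge V => Sym2.lift ⟨fun x y => f x + f y, fun _ _ => add_comm _ _⟩ e.1) M := by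
    clear hM
    induction M using Multiset.induction_on with
    | empty => simp
    | cons e M ih =>
      obtain ⟨e, a⟩ := e
      induction e with | _ p q
      simp only [wt_cons, cut_mk, Nat.cast_add, ih, Sym2.lift_mk, f]
      by_cases h1 : p ∈ Z <;> by_cases h2 : q ∈ Z <;> simp [h1, h2]; rfl
  rw [← ZMod.natCast_eq_zero_iff_even, h, wt_lift_eq_sum, Finset.sum_eq_zero]
  intro w _
  rw [(ZMod.natCast_eq_zero_iff_even).2 (hM w), zero_mul]

/-! ### Submodularity and stars -/

theorem cost_meet_join (s t : V → SignType) (M : Multiset (SEdge V)) :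
    wt (cost fun x => meet (s x) (t x)) M + wt (cost fun x => join (s x) (t x)) M
      ≤ wt (cost s) M + wt (cost t) M := by
  rw [← wt_fun_add, ← wt_fun_add]
  refine wt_le fun ⟨e, a⟩ _ => ?_
  induction e with | _ p q
  exact gap_meet_join a _ _ _ _

theorem cut_inter_union (Z Z' : Finset V) (M : Multiset (SEdge V)) :
    wt (cut (Z ∩ Z')) M + wt (cut (Z ∪ Z')) M ≤ wt (cut Z) M + wt (cut Z') M := by
  rw [← wt_fun_add, ← wt_fun_add]
  refine wt_le fun ⟨e, a⟩ _ => ?_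
  induction e with | _ p q
  simp only [cut_mk, Finset.mem_inter, Finset.mem_union]
  by_cases h1 : p ∈ Z <;> by_cases h2 : q ∈ Z <;> by_cases h3 : p ∈ Z' <;>
    by_cases h4 : q ∈ Z' <;> simp [h1, h2, h3, h4]

theorem cost_congr {s t : V → SignType} {M : Multiset (SEdge V)}
    (h : ∀ x, 0 < wt (deg x) M → s x = t x) : wt (cost s) M = wt (cost t) M := by
  refine wt_congr fun ⟨e, a⟩ he => ?_
  induction e with | _ p q
  have h1 := h p (lt_of_lt_of_le (by simp) (le_wt (deg p) he))
  have h2 := h q (lt_of_lt_of_le (by simp) (le_wt (deg q) he))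
  simp [h1, h2]

theorem cut_congr {Z Z' : Finset V} {M : Multiset (SEdge V)}
    (h : ∀ x, 0 < wt (deg x) M → (x ∈ Z ↔ x ∈ Z')) : wt (cut Z) M = wt (cut Z') M := by
  refine wt_congr fun ⟨e, a⟩ he => ?_
  induction e with | _ p q
  have h1 := h p (lt_of_lt_of_le (by simp) (le_wt (deg p) he))
  have h2 := h q (lt_of_lt_of_le (by simp) (le_wt (deg q) he))
  simp [h1, h2]

/-- The edges at a vertex without loops form a star. -/
theorem exists_star {M : Multiset (SEdge V)} {u : V} (hl : ∀ a, (s(u, u), a) ∉ M) :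
    ∃ (n : ℕ) (x : Fin n → V) (a : Fin n → ZMod 2) (R : Multiset (SEdge V)),
      M = Finset.univ.val.map (fun i => (s(u, x i), a i)) + R ∧ (∀ i, x i ≠ u) ∧
      wt (deg u) R = 0 ∧ wt (deg u) M = n := by
  obtain ⟨l, hlist⟩ := Quot.exists_rep (M.filter fun e => u ∈ e.1)
  change (↑l : Multiset (SEdge V)) = _ at hlist
  have hmem : ∀ i : Fin l.length, ∃ y, l.get i = (s(u, y), (l.get i).2) ∧ y ≠ u := by
    intro i
    have h1 : l.get i ∈ (l : Multiset (SEdge V)) := by simp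
    rw [hlist, Multiset.mem_filter] at h1
    obtain ⟨y, hy⟩ := h1.2
    refine ⟨y, by rw [← hy], ?_⟩
    rintro rfl
    exact hl (l.get i).2 (by rw [← hy]; exact h1.1)
  choose x hx hxu using hmem
  have hM : M = Finset.univ.val.map (fun i => (s(u, x i), (l.get i).2)) +
      M.filter (fun e => ¬ u ∈ e.1) := by
    conv_lhs => rw [← Multiset.filter_add_not (fun e : SEdge V => u ∈ e.1) M]
    congr 1
    rw [← hlist, ← funext hx, Fin.univ_val_map, List.ofFn_get]
  have hR : wt (deg u) (M.filter fun e => ¬ u ∈ e.1) = 0 := by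
    rw [wt_eq_zero]
    rintro ⟨e, a⟩ he
    induction e with | _ p q
    rw [Multiset.mem_filter] at he
    simp only [Sym2.mem_iff, not_or] at he
    simp [Ne.symm he.2.1, Ne.symm he.2.2]
  refine ⟨l.length, x, fun i => (l.get i).2, _, hM, hxu, hR, ?_⟩
  conv_lhs => rw [hM]
  rw [wt_add, hR, wt_univ]
  simp [hxu]

/-- Splitting off two edges of a star. -/
theorem star_split {ι : Type*} [Fintype ι] [DecidableEq ι] {x : ι → V} {a : ι → ZMod 2} {u : V}
    {S : Finset V} (hu : u ∉ S) {M R : Multiset (SEdge V)}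
    (hM : M = Finset.univ.val.map (fun i => (s(u, x i), a i)) + R) {i j : ι} (hij : i ≠ j) :
    ∃ N, Step S M N ∧ ∀ f : SEdge V → ℕ, wt f N + (f (s(u, x i), a i) + f (s(u, x j), a j))
      = wt f M + f (s(x i, x j), a i + a j) := by
  let e : ι → SEdge V := fun i => (s(u, x i), a i)
  have h1 : (Finset.univ : Finset ι).val = i ::ₘ j ::ₘ ((Finset.univ.erase i).erase j).val := by
    rw [Finset.erase_val, Multiset.cons_erase, Finset.erase_val, Multiset.cons_erase]
    · simp
    · exact (Multiset.mem_erase_of_ne hij.symm).2 (by simp)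
  have h2 : M = (s(x i, u), a i) ::ₘ (s(u, x j), a j) ::ₘ
      (((Finset.univ.erase i).erase j).val.map e + R) := by
    rw [hM, h1, Sym2.eq_swap (a := x i)]
    simp [e]
  refine ⟨(s(x i, x j), a i + a j) ::ₘ (((Finset.univ.erase i).erase j).val.map e + R),
    ⟨u, x i, x j, a i, a j, _, hu, h2, rfl⟩, fun f => ?_⟩
  rw [h2, Sym2.eq_swap (a := u) (b := x i)]
  simp only [wt_cons]
  ring

theorem star_cost {ι : Type*} [Fintype ι] {x : ι → V} {a : ι → ZMod 2} {u : V}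
    {M R : Multiset (SEdge V)} (hM : M = Finset.univ.val.map (fun i => (s(u, x i), a i)) + R)
    (s : V → SignType) :
    wt (cost s) M = ∑ i, gap (s u) (act (a i) (s (x i))) + wt (cost s) R := by
  rw [hM, wt_add, wt_univ]; rfl

theorem star_cut {ι : Type*} [Fintype ι] {x : ι → V} {a : ι → ZMod 2} {u : V}
    {M R : Multiset (SEdge V)} (hM : M = Finset.univ.val.map (fun i => (s(u, x i), a i)) + R)
    (Z : Finset V) :
    wt (cut Z) M = ∑ i, (if (u ∈ Z ↔ x i ∈ Z) then 0 else 1) + wt (cut Z) R := by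
  rw [hM, wt_add, wt_univ]; rfl

theorem card_cross_le {ι : Type*} [Fintype ι] {x : ι → V} {a : ι → ZMod 2} {u : V}
    {M R : Multiset (SEdge V)} (hM : M = Finset.univ.val.map (fun i => (s(u, x i), a i)) + R)
    {Z : Finset V} (hu : u ∈ Z) {J : Finset ι} (hJ : ∀ j ∈ J, x j ∉ Z) :
    J.card + wt (cut Z) R ≤ wt (cut Z) M := by
  rw [star_cut hM, Finset.card_eq_sum_ones]
  gcongr
  calc ∑ j ∈ J, 1 = ∑ j ∈ J, (if (u ∈ Z ↔ x j ∈ Z) then 0 else 1) :=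
        Finset.sum_congr rfl fun j hj => by simp [hu, hJ j hj]
    _ ≤ _ := Finset.sum_le_sum_of_subset (Finset.subset_univ _)

theorem exists_edge_of_cut {v : V} {Z : Finset V} (hv : ∀ x, x ∉ Z → x = v)
    {M : Multiset (SEdge V)} (h : wt (cut Z) M ≠ 0) :
    ∃ u a, u ∈ Z ∧ (s(v, u), a) ∈ M ∧ v ∉ Z := by
  rw [Ne, wt_eq_zero] at h
  push Not at h
  obtain ⟨⟨e, a⟩, he, hc⟩ := h
  induction e with | _ p q
  by_cases h1 : p ∈ Z <;> by_cases h2 : q ∈ Z <;> simp [h1, h2] at hc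
  · obtain rfl := hv _ h2
    exact ⟨p, a, h1, by rwa [Sym2.eq_swap], h2⟩
  · obtain rfl := hv _ h1
    exact ⟨q, a, h2, he, h1⟩

theorem sum_deg_lt [Fintype V] {v u : V} (hu : u ≠ v) {M N : Multiset (SEdge V)}
    (h : ∀ w, wt (deg w) N ≤ wt (deg w) M) (h' : wt (deg u) N < wt (deg u) M) :
    ∑ w ∈ Finset.univ.erase v, wt (deg w) N < ∑ w ∈ Finset.univ.erase v, wt (deg w) M :=
  Finset.sum_lt_sum (fun w _ => h w) ⟨u, by simp [hu], h'⟩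

/-! ### Splitting everything off onto a root -/

theorem ind_cost_union (W W' : Finset V) (M : Multiset (SEdge V)) :
    wt (cost (ind (W ∩ W'))) M + wt (cost (ind (W ∪ W'))) M ≤
      wt (cost (ind W)) M + wt (cost (ind W')) M := by
  have h := cost_meet_join (ind W) (ind W') M
  have h1 : (fun x => meet (ind W x) (ind W' x)) = ind (W ∩ W') := by
    funext x; by_cases h1 : x ∈ W <;> by_cases h2 : x ∈ W' <;> simp [ind, h1, h2, meet]
  have h2 : (fun x => join (ind W x) (ind W' x)) = ind (W ∪ W') := by
    funext x; by_cases h1 : x ∈ W <;> by_cases h2 : x ∈ W' <;> simp [ind, h1, h2, join]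
  rwa [h1, h2] at h

/-- `ind W` costs the number of edges leaving W plus twice the number of odd edges inside W. With at
most k odd edges, the bound 2 * k is the cut condition for 2k edge-disjoint paths from v to the ends
of the odd edges, and tight sets uncross as in Menger's theorem. For k = 0 only connectivity to v is
left. -/
theorem red_to_root [Fintype V] (v : V) (k : ℕ) (M : Multiset (SEdge V))
    (heven : ∀ w, Even (wt (deg w) M))
    (hconn : ∀ Z, v ∉ Z → wt (cut Z) M = 0 → ∀ w ∈ Z, wt (deg w) M = 0)
    (hc : ∀ W, v ∈ W → 2 * k ≤ wt (cost (ind W)) M)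
    (hk : k = 0 ∨ wt (cost (ind Finset.univ)) M ≤ 2 * k) :
    ∃ N, Red {v} M N ∧ (∀ w, w ≠ v → wt (deg w) N = 0) ∧ 2 * k ≤ wt (cost (ind {v})) N := by
  induction hm : ∑ w ∈ Finset.univ.erase v, wt (deg w) M using Nat.strong_induction_on
    generalizing M with | _ m ih
  by_cases hdone : ∀ w, w ≠ v → wt (deg w) M = 0
  · exact ⟨M, .refl, hdone, hc _ (by simp)⟩
  push Not at hdone
  obtain ⟨w₀, hw₀, hw₀'⟩ := hdone
  have hcutv : wt (cut (Finset.univ.erase v)) M ≠ 0 := fun h =>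
    hw₀' (hconn _ (by simp) h w₀ (by simp [hw₀]))
  -- a suitable edge at the root
  obtain ⟨u, α, huv, hh, hα⟩ : ∃ u α, u ≠ v ∧ (s(v, u), α) ∈ M ∧ (k = 0 ∨ α = 0) := by
    by_cases hk0 : k = 0
    · obtain ⟨u, α, hu, he, -⟩ := exists_edge_of_cut (v := v) (by simp) hcutv
      exact ⟨u, α, by simpa using hu, he, .inl hk0⟩
    by_contra! hcon
    apply hcutv
    -- If all edges leaving v were odd, each would count once for `ind {v}` and twice for `ind
    -- univ`. These costs are at least and at most 2 * k, so no edge could leave v.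
    have : wt (cost (ind {v})) M + wt (cut (Finset.univ.erase v)) M ≤
        wt (cost (ind Finset.univ)) M := by
      rw [← wt_fun_add]
      refine wt_le fun ⟨e, a⟩ he => ?_
      induction e with | _ p q
      have h01 : a = 0 ∨ a = 1 := (by decide : ∀ a : ZMod 2, a = 0 ∨ a = 1) a
      by_cases hp : p = v <;> by_cases hq : q = v
      · simp [hp, hq, ind]
      · have h1 := (hcon q a hq (hp ▸ he)).2
        obtain rfl := h01.resolve_left h1
        simp [hp, hq, ind]; decide
      · have h1 := (hcon p a hp (by rw [Sym2.eq_swap]; exact hq ▸ he)).2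
        obtain rfl := h01.resolve_left h1
        simp [hp, hq, ind]; decide
      · simp [hp, hq, ind, act_self_zero, gap]
    have h1 := hc {v} (by simp)
    have h2 := hk.resolve_left hk0
    omega
  -- it is enough to find a good step
  suffices H : ∃ N, Step {v} M N ∧ wt (deg u) N < wt (deg u) M ∧
      (∀ Z, v ∉ Z → wt (cut Z) N = 0 → ∀ w ∈ Z, wt (deg w) N = 0) ∧
      (∀ W, v ∈ W → 2 * k ≤ wt (cost (ind W)) N) by
    obtain ⟨N, hMN, hdeg, hconn', hc'⟩ := H
    obtain ⟨N', h1, h2⟩ := ih _ (hm ▸ sum_deg_lt huv hMN.deg_le hdeg) N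
      (fun w => hMN.even_deg (heven w)) hconn' hc' (hk.imp_right (hMN.cost_le _).trans) rfl
    exact ⟨N', h1.head hMN, h2⟩
  -- A loop at u is absorbed into the edge from v. If that edge is even, no relevant cost changes;
  -- otherwise k = 0 and there is no cost condition.
  by_cases hl : ∃ b, (s(u, u), b) ∈ M
  · obtain ⟨b, hb⟩ := hl
    obtain ⟨R, rfl⟩ := Multiset.exists_cons_of_mem hh
    rw [Multiset.mem_cons] at hb
    replace hb : (s(u, u), b) ∈ R := by
      refine hb.resolve_left fun h => huv ?_
      simp only [Prod.mk.injEq, Sym2.eq_iff] at h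
      tauto
    obtain ⟨R, rfl⟩ := Multiset.exists_cons_of_mem hb
    have hstep : Step {v} ((s(v, u), α) ::ₘ (s(u, u), b) ::ₘ R) ((s(v, u), α + b) ::ₘ R) :=
      ⟨u, v, u, α, b, R, by simp [huv], rfl, rfl⟩
    refine ⟨_, hstep, by simp [huv.symm], fun Z hvZ hZ w hw => ?_, fun W hW => ?_⟩
    · have := hconn Z hvZ (by simpa using hZ) w hw
      have := hstep.deg_le w
      omega
    · obtain rfl | rfl := hα
      · simp
      refine (hc W hW).trans (le_of_eq ?_)
      by_cases hu : u ∈ W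
      · simp [ind, hu, hW, act_zero, gap]
      · simp [ind, hu, hW, act_self_zero]; simp [gap]
  push Not at hl
  obtain ⟨n, x, a, R, hM, hxu, hR, hn⟩ := exists_star hl
  obtain ⟨p, hp, hap⟩ : ∃ p, x p = v ∧ a p = α := by
    rw [hM, Multiset.mem_add] at hh
    obtain h | h := hh
    · obtain ⟨i, -, hi⟩ := Multiset.mem_map.1 h
      simp only [Prod.mk.injEq, Sym2.eq_iff] at hi
      exact ⟨i, by tauto, hi.2⟩
    · have := (wt_eq_zero.1 hR) _ h
      simp at this
  by_contra hbad
  have hpu : 0 < wt (deg u) M := by rw [hn]; exact p.pos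
  have hsplit := fun j (hj : p ≠ j) => star_split (S := {v}) (by simp [huv]) hM hj
  -- the two kinds of bad edges
  let P₁ : Finset V → Prop := fun W => v ∈ W ∧ u ∉ W ∧ wt (cost (ind W)) M ≤ 2 * k
  let P₂ : Finset V → Prop := fun Z => v ∉ Z ∧ u ∈ Z ∧ wt (cut Z) M ≤ 2
  -- The clause for n = 2 supplies a second nonisolated vertex of Z: u itself may become isolated
  -- without harm.
  have hbad' : ∀ j, p ≠ j → (∃ W, P₁ W ∧ x j ∈ W ∧ a j = 0 ∧ a p = 0) ∨
      (∃ Z, P₂ Z ∧ x j ∉ Z ∧ (n = 2 → ∃ w ∈ Z, w ≠ u ∧ 0 < wt (deg w) M)) := by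
    intro j hj
    obtain ⟨N, hMN, hN⟩ := hsplit j hj
    have hdN : wt (deg u) N + 2 = wt (deg u) M := by
      have := hN (deg u)
      simp [hxu] at this
      omega
    by_cases h1 : ∃ W, v ∈ W ∧ wt (cost (ind W)) N < 2 * k
    · obtain ⟨W, hvW, hW⟩ := h1
      left
      have hap0 : a p = 0 := hap ▸ hα.resolve_left (by omega)
      have hloss := hN (cost (ind W))
      have hcW := hc W hvW
      have hev := even_cost (ind W) heven
      have key : ∀ b q r, (q = 0 ∨ q = 1) → (r = 0 ∨ r = 1) → gap 1 (act (0 + b) r) <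
          gap q (act 0 1) + gap q (act b r) → q = 0 ∧ r = 1 ∧ b = 0 ∧ gap 1 (act (0 + b) r) + 2 =
          gap q (act 0 1) + gap q (act b r) := by decide
      have h01 : ∀ w, ind W w = 0 ∨ ind W w = 1 := by
        intro w; unfold ind; split_ifs <;> simp
      have h1v : ind W v = 1 := by simp [ind, hvW]
      simp only [cost_mk, hp, hap0, h1v] at hloss
      obtain ⟨h2, h3, h4, h5⟩ := key (a j) _ _ (h01 u) (h01 (x j)) (by omega)
      have h6 : u ∉ W := by intro h; simp [ind, h] at h2
      have h7 : x j ∈ W := by by_contra h; simp [ind, h] at h3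
      refine ⟨W, ⟨hvW, h6, ?_⟩, h7, h4, hap0⟩
      obtain ⟨t, ht⟩ := hev
      omega
    · right
      push Not at h1
      have h2 : ¬ ∀ Z, v ∉ Z → wt (cut Z) N = 0 → ∀ w ∈ Z, wt (deg w) N = 0 := fun h =>
        hbad ⟨N, hMN, by omega, h, h1⟩
      push Not at h2
      obtain ⟨Z, hvZ, hZ, w, hw, hwd⟩ := h2
      have hwM : 0 < wt (deg w) M := lt_of_lt_of_le (Nat.pos_of_ne_zero hwd) (hMN.deg_le w)
      have hne : wt (cut Z) M ≠ 0 := fun h => hwM.ne' (hconn Z hvZ h w hw)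
      have hloss := hN (cut Z)
      simp only [cut_mk, hp, hvZ, hZ] at hloss
      have huZ : u ∈ Z := by
        by_contra h
        simp [h] at hloss
        omega
      have hxj : x j ∉ Z := by
        intro h
        simp [h, huZ] at hloss
        omega
      simp [huZ, hxj] at hloss
      refine ⟨Z, ⟨hvZ, huZ, by omega⟩, hxj, fun hn2 => ⟨w, hw, ?_, hwM⟩⟩
      rintro rfl
      omega
  classical
  let B₁ : Finset (Fin n) := {j | p ≠ j ∧ ∃ W, P₁ W ∧ x j ∈ W ∧ a j = 0 ∧ a p = 0}
  let B₂ : Finset (Fin n) := {j | p ≠ j ∧ ∃ Z, P₂ Z ∧ x j ∉ Z ∧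
    (n = 2 → ∃ w ∈ Z, w ≠ u ∧ 0 < wt (deg w) M)}
  have hcover : n ≤ 1 + B₁.card + B₂.card := by
    have : (Finset.univ : Finset (Fin n)) ⊆ ({p} ∪ B₁) ∪ B₂ := by
      intro j _
      by_cases hj : p = j
      · simp [hj]
      · rcases hbad' j hj with h | h
        · simp only [Finset.mem_union]; left; right; simp only [B₁, Finset.mem_filter_univ]
          exact ⟨hj, h⟩
        · simp only [Finset.mem_union]; right; simp only [B₂, Finset.mem_filter_univ]
          exact ⟨hj, h⟩
    have := Finset.card_le_card this
    have h2 := Finset.card_union_le ({p} ∪ B₁) B₂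
    have h3 := Finset.card_union_le {p} B₁
    rw [Finset.card_univ, Fintype.card_fin] at this
    rw [Finset.card_singleton] at h3
    omega
  -- The tight sets uncross to one set W containing all ends in question. Adding u to W saves one on
  -- each edge of B₁ ∪ {p} and costs at most one on each other edge at u; by `hc` there is no net
  -- saving.
  have hB₁ : B₁.Nonempty → 2 * (B₁.card + 1) ≤ n := by
    intro hne
    have hall : ∀ J : Finset (Fin n), J.Nonempty → J ⊆ B₁ → ∃ W, P₁ W ∧ ∀ j ∈ J, x j ∈ W := by
      intro J hJ
      induction hJ using Finset.Nonempty.cons_induction with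
      | singleton j =>
        intro hj
        obtain ⟨-, W, hW, h1, -⟩ := (Finset.mem_filter_univ _).1 (hj (Finset.mem_singleton_self j))
        exact ⟨W, hW, by simpa using h1⟩
      | cons j J hj hJ ihJ =>
        intro hJB
        obtain ⟨W, hW, hWJ⟩ := ihJ fun i hi => hJB (by simp [hi])
        obtain ⟨-, W', hW', h1, -⟩ := (Finset.mem_filter_univ _).1 (hJB (Finset.mem_cons_self j J))
        have h2 := ind_cost_union W W' M
        have h3 := hc (W ∩ W') (by simp [hW.1, hW'.1])
        refine ⟨W ∪ W', ⟨by simp [hW.1], by simp [hW.2.1, hW'.2.1], ?_⟩, ?_⟩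
        · have h4 := hW.2.2
          have h5 := hW'.2.2
          omega
        · intro i hi
          rcases Finset.mem_cons.1 hi with rfl | hi
          · simp [h1]
          · simp [hWJ i hi]
    obtain ⟨W, ⟨hvW, huW, hcW⟩, hWB⟩ := hall B₁ hne subset_rfl
    have h1 := hc (insert u W) (by simp [hvW])
    rw [star_cost hM] at h1 hcW
    have hRR : wt (cost (ind (insert u W))) R = wt (cost (ind W)) R := by
      refine cost_congr fun y hy => ?_
      have : y ≠ u := by rintro rfl; omega
      simp [ind, this]
    let C : Finset (Fin n) := insert p B₁
    have hC : C.card = B₁.card + 1 := Finset.card_insert_of_notMem (by simp [B₁])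
    have hCy : ∀ i ∈ C, act (a i) (ind W (x i)) = 1 := by
      intro i hi
      have hp0 : ∀ j ∈ B₁, a j = 0 ∧ a p = 0 := fun j hj => by
        obtain ⟨-, W', -, -, h⟩ := (Finset.mem_filter_univ _).1 hj
        exact h
      rcases Finset.mem_insert.1 hi with rfl | hi
      · obtain ⟨j, hj⟩ := hne
        rw [(hp0 j hj).2, act_zero, hp]; simp [ind, hvW]
      · rw [(hp0 i hi).1, act_zero]; simp [ind, hWB i hi]
    have h2 : ∑ i, gap (ind (insert u W) u) (act (a i) (ind (insert u W) (x i))) + 2 * C.card ≤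
        ∑ i, gap (ind W u) (act (a i) (ind W (x i))) + n := by
      have hsum : ∑ i : Fin n, 1 = n := by simp
      have hC' : 2 * C.card = ∑ i : Fin n, if i ∈ C then 2 else 0 := by
        simp [mul_comm]
      rw [hC']
      refine le_of_le_of_eq ?_ (congrArg _ hsum)
      rw [← Finset.sum_add_distrib, ← Finset.sum_add_distrib]
      refine Finset.sum_le_sum fun i _ => ?_
      have e1 : ind (insert u W) (x i) = ind W (x i) := by simp [ind, hxu i]
      have e2 : ind (insert u W) u = 1 := by simp [ind]
      have e3 : ind W u = 0 := by simp [ind, huW]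
      rw [e1, e2, e3]
      by_cases hi : i ∈ C
      · rw [hCy i hi]; simp [hi]; decide
      · simp only [hi, if_false]
        generalize act (a i) (ind W (x i)) = q
        revert q; decide
    omega
  -- The union of two such cuts has at least two edges, so their intersection has at most two, yet
  -- three star edges leave it.
  have hB₂ : B₂.card ≤ 1 := by
    rw [Finset.card_le_one]
    intro j hj j' hj'
    by_contra hjj
    obtain ⟨hpj, Z, ⟨hvZ, huZ, hZ⟩, hxj, -⟩ := (Finset.mem_filter_univ _).1 hj
    obtain ⟨hpj', Z', ⟨hvZ', huZ', hZ'⟩, hxj', -⟩ := (Finset.mem_filter_univ _).1 hj'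
    have h1 := cut_inter_union Z Z' M
    have h2 : wt (cut (Z ∪ Z')) M ≠ 0 := fun h =>
      hpu.ne' (hconn _ (by simp [hvZ, hvZ']) h u (by simp [huZ]))
    have h3 := card_cross_le hM (Z := Z ∩ Z') (by simp [huZ, huZ']) (J := {p, j, j'}) (by
      simp [hp, hvZ, hxj, hxj'])
    rw [Finset.card_insert_of_notMem (by simp [hpj, hpj']), Finset.card_pair hjj] at h3
    obtain ⟨t, ht⟩ := even_cut (Z ∪ Z') heven
    omega
  -- Counting and parity leave only n = 2 with B₁ empty. Then both edges at u leave Z, and Z without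
  -- u is separated from the root.
  obtain ⟨t, ht⟩ := heven u
  rcases B₁.eq_empty_or_nonempty with h0 | h0
  · rw [h0, Finset.card_empty] at hcover
    have hn2 : n = 2 := by omega
    obtain ⟨j, hj⟩ : B₂.Nonempty := by rw [← Finset.card_pos]; omega
    obtain ⟨hpj, Z, ⟨hvZ, huZ, hZ⟩, hxj, hw⟩ := (Finset.mem_filter_univ _).1 hj
    obtain ⟨w, hwZ, hwu, hwd⟩ := hw hn2
    have hx : ∀ i, x i ∉ Z := by
      intro i
      have : ({p, j} : Finset (Fin n)) = Finset.univ := by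
        apply Finset.eq_univ_of_card
        rw [Finset.card_pair hpj]; simp [hn2]
      have hi : i ∈ ({p, j} : Finset (Fin n)) := by rw [this]; simp
      simp at hi
      rcases hi with rfl | rfl
      · rwa [hp]
      · exact hxj
    have h3 := card_cross_le hM huZ (J := Finset.univ) (fun i _ => hx i)
    simp at h3
    refine hwd.ne' (hconn (Z.erase u) (by simp [hvZ]) ?_ w (by simp [hwu, hwZ]))
    rw [star_cut hM]
    have hRR : wt (cut (Z.erase u)) R = wt (cut Z) R := by
      refine cut_congr fun y hy => ?_
      have : y ≠ u := by rintro rfl; omega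
      simp [this]
    rw [hRR]
    have : wt (cut Z) R = 0 := by omega
    simp [this, hx]
  · have := hB₁ h0
    have := Finset.card_pos.2 h0
    omega

/-! ### Rooted multigraphs and pairs of obstructing labellings -/

/-- The conditions on a root `v` that allow to reduce a signed multigraph to three odd loops. -/
structure IsRooted (v : V) (M : Multiset (SEdge V)) : Prop where
  even : ∀ w, Even (wt (deg w) M)
  deg_le : ∀ w, w ≠ v → wt (deg w) M ≤ 6
  cost_ge : ∀ s, s v = 1 → 6 ≤ wt (cost s) M
  cost_le : wt (cost (ind {v})) M ≤ 6
  cut_ge : ∀ Z, v ∉ Z → (∃ w ∈ Z, 0 < wt (deg w) M) → 4 ≤ wt (cut Z) M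
  odd : wt Prod.snd M = 1

theorem IsRooted.of_red {v : V} {M N : Multiset (SEdge V)} (h : IsRooted v M) (H : Red {v} M N)
    (hcost : ∀ s, s v = 1 → 6 ≤ wt (cost s) N)
    (hcut : ∀ Z, v ∉ Z → (∃ w ∈ Z, 0 < wt (deg w) N) → 4 ≤ wt (cut Z) N) : IsRooted v N where
  even w := H.even_deg (h.even w)
  deg_le w hw := (H.deg_le w).trans (h.deg_le w hw)
  cost_ge := hcost
  cost_le := (H.cost_le _).trans h.cost_le
  cut_ge := hcut
  odd := H.sign_eq.trans h.odd

/-- All labellings except the trivial one have cost at least `8`. -/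
def IsStrict (v : V) (M : Multiset (SEdge V)) : Prop :=
  ∀ s : V → SignType, s v = 1 → (∃ w, w ≠ v ∧ 0 < wt (deg w) M ∧ s w ≠ 0) → 8 ≤ wt (cost s) M

/-- Meet and join cost at least 6 each, and at least 8 if nontrivial, so a total of 12 makes both
vanish off v. Labels with zero meet and zero join are opposite. -/
theorem trivial_of_meet_join {v : V} {M : Multiset (SEdge V)} (h : IsRooted v M)
    (hs : IsStrict v M) {s t : V → SignType} (hsv : s v = 1) (htv : t v = 1)
    (hc : wt (cost fun x => meet (s x) (t x)) M + wt (cost fun x => join (s x) (t x)) M ≤ 12) :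
    ∀ w, w ≠ v → 0 < wt (deg w) M → t w = -s w := by
  intro w hw hd
  have h1 : meet (s v) (t v) = 1 := by rw [hsv, htv]; rfl
  have h2 : join (s v) (t v) = 1 := by rw [hsv, htv]; rfl
  have h3 := h.cost_ge (fun x => meet (s x) (t x)) h1
  have h4 := h.cost_ge (fun x => join (s x) (t x)) h2
  have h5 : meet (s w) (t w) = 0 := by
    by_contra h0
    have := hs (fun x => meet (s x) (t x)) h1 ⟨w, hw, hd, h0⟩
    omega
  have h6 : join (s w) (t w) = 0 := by
    by_contra h0
    have := hs (fun x => join (s x) (t x)) h2 ⟨w, hw, hd, h0⟩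
    omega
  revert h5 h6
  generalize s w = p
  generalize t w = q
  revert p q
  decide

theorem act_one : ∀ a, act a 1 = 1 ∨ act a 1 = -1 := by decide

/-- The contribution of one edge to `ne_zero_of_opposite`. The Booleans record whether an end is v
or u; the second labelling is negated away from v. -/
theorem gap_opposite : ∀ (a : ZMod 2) (p q : SignType) (pv pu qv qu : Bool),
    (pv = true → p = 1 ∧ ¬ pu = true) → (qv = true → q = 1 ∧ ¬ qu = true) →
    (pu = true → p = 0) → (qu = true → q = 0) →
    (pu = true → q = 0 → qu = true) → (qu = true → p = 0 → pu = true) →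
    (if (¬ pv = true ∧ p ≠ 0 ↔ ¬ qv = true ∧ q ≠ 0) then 0 else 1) +
    (if (¬ pu = true ∧ p = 0 ↔ ¬ qu = true ∧ q = 0) then 0 else 1) +
    (if (pu = true ↔ qu = true) then 0 else 1) +
    gap (if pv = true then 1 else 0) (act a (if qv = true then 1 else 0)) ≤
    gap p (act a q) + gap (if pv = true then p else -p) (act a (if qv = true then q else -q)) := by
  intro a p q pv pu qv qu
  revert a p q
  cases pv <;> cases pu <;> cases qv <;> cases qu <;> simp <;> decide

/-- The two opposite labellings pay for the boundaries of X, Y and {u} and for the trivial labelling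
simultaneously. A nonisolated vertex in Y would give 4 + 4 + 4 + 6 > 16, or 4 + 4 + 6 > 12 when the
boundary of X is not counted. -/
theorem ne_zero_of_opposite {v : V} [Fintype V] {M : Multiset (SEdge V)} (h : IsRooted v M) {u : V}
    (huv : u ≠ v) (hu : 0 < wt (deg u) M) {s t : V → SignType} (hsv : s v = 1) (htv : t v = 1)
    (hsu : s u = 0) (hc : wt (cost s) M + wt (cost t) M ≤ 16)
    (hopp : ∀ w, w ≠ v → 0 < wt (deg w) M → t w = -s w)
    (hX : (∃ w, w ≠ v ∧ 0 < wt (deg w) M ∧ s w ≠ 0) ∨ wt (cost s) M + wt (cost t) M ≤ 12)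
    (hno : ∀ y b, (s(u, y), b) ∈ M → y = u ∨ s y ≠ 0) :
    ∀ w, w ≠ u → 0 < wt (deg w) M → s w ≠ 0 := by
  intro w hwu hw hsw
  let X : Finset V := {w | w ≠ v ∧ s w ≠ 0}
  let Y : Finset V := {w | w ≠ u ∧ s w = 0}
  have h1 : 4 ≤ wt (cut X) M ∨ wt (cost s) M + wt (cost t) M ≤ 12 := by
    refine hX.imp_left fun ⟨x, hxv, hx, hsx⟩ => ?_
    exact h.cut_ge X (by simp [X]) ⟨x, by simp [X, hxv, hsx], hx⟩
  have h2 := h.cut_ge Y (by simp [Y, hsv]) ⟨w, by simp [Y, hwu, hsw], hw⟩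
  have h3 := h.cut_ge {u} (by simp [huv.symm]) ⟨u, by simp, hu⟩
  have h4 := h.cost_ge (ind {v}) (by simp [ind])
  have key : wt (cut X) M + wt (cut Y) M + wt (cut {u}) M + wt (cost (ind {v})) M ≤
      wt (cost s) M + wt (cost t) M := by
    rw [← wt_fun_add, ← wt_fun_add, ← wt_fun_add, ← wt_fun_add]
    refine wt_le fun ⟨e, a⟩ he => ?_
    induction e with | _ p q
    have dp : 0 < wt (deg p) M := lt_of_lt_of_le (by simp) (le_wt (deg p) he)
    have dq : 0 < wt (deg q) M := lt_of_lt_of_le (by simp) (le_wt (deg q) he)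
    have npq : p = u → s q = 0 → q = u := fun hp hq =>
      (hno q a (hp ▸ he)).resolve_right (by simp [hq])
    have nqp : q = u → s p = 0 → p = u := fun hq hp =>
      (hno p a (by rw [Sym2.eq_swap]; exact hq ▸ he)).resolve_right (by simp [hp])
    have tp : p ≠ v → t p = -s p := fun hp => hopp p hp dp
    have tq : q ≠ v → t q = -s q := fun hq => hopp q hq dq
    have k := gap_opposite a (s p) (s q) (decide (p = v)) (decide (p = u)) (decide (q = v))
      (decide (q = u)) (by simp; rintro rfl; exact ⟨hsv, huv.symm⟩)
      (by simp; rintro rfl; exact ⟨hsv, huv.symm⟩) (by simp; rintro rfl; exact hsu)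
      (by simp; rintro rfl; exact hsu) (by simpa using npq) (by simpa using nqp)
    have ep : (if decide (p = v) = true then s p else -s p) = t p := by
      by_cases hp : p = v
      · simp [hp, hsv, htv]
      · simp [hp, tp hp]
    have eq : (if decide (q = v) = true then s q else -s q) = t q := by
      by_cases hq : q = v
      · simp [hq, hsv, htv]
      · simp [hq, tq hq]
    rw [ep, eq] at k
    simpa only [cut_mk, cost_mk, X, Y, Finset.mem_filter_univ, Finset.mem_singleton, ind,
      decide_eq_true_eq] using k
  omega

/-- The indicator function of the label `-1`. -/
def neg1 (p : SignType) : ZMod 2 := if p = -1 then 1 else 0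

/-- The sum of `f` over the two ends of an edge. -/
def ends (f : V → ZMod 2) (e : SEdge V) : ZMod 2 :=
  Sym2.lift ⟨fun x y => f x + f y, fun _ _ => add_comm _ _⟩ e.1

@[simp] theorem ends_mk (f : V → ZMod 2) (x y : V) (a : ZMod 2) :
    ends f (s(x, y), a) = f x + f y := rfl

theorem wt_ends_eq_zero [Fintype V] (f : V → ZMod 2) {M : Multiset (SEdge V)}
    (hM : ∀ w, Even (wt (deg w) M)) : wt (ends f) M = 0 := by
  refine (wt_lift_eq_sum f M).trans (Finset.sum_eq_zero fun w _ => ?_)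
  rw [(ZMod.natCast_eq_zero_iff_even).2 (hM w), zero_mul]

/-- With nonzero labels an edge costs 0 or 2, and it costs 2 exactly when it is odd after switching
at the ends labelled -1. Half the cost therefore records a parity of signs. -/
theorem cost_eq_two_mul {s : V → SignType} {R : Multiset (SEdge V)}
    (hs : ∀ w, 0 < wt (deg w) R → s w ≠ 0) :
    ∃ m : ℕ, wt (cost s) R = 2 * m ∧ wt Prod.snd R + wt (ends fun w => neg1 (s w)) R = m := by
  induction R using Multiset.induction_on with
  | empty => exact ⟨0, by simp⟩
  | cons e R ih =>
    obtain ⟨m, h1, h2⟩ := ih fun w hw => hs w (by simp; omega)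
    obtain ⟨e, a⟩ := e
    induction e with | _ p q
    have hp := hs p (by simp)
    have hq := hs q (by simp)
    have key : ∀ a p q, p ≠ 0 → q ≠ 0 → ∃ m : Fin 2, gap p (act a q) = 2 * m ∧
      a + (neg1 p + neg1 q) = ((m : ℕ) : ZMod 2) := by decide
    obtain ⟨m', h3, h4⟩ := key a _ _ hp hq
    refine ⟨m' + m, by simp [h1, h3, mul_add], ?_⟩
    simp only [wt_cons, ends_mk, Nat.cast_add, ← h4, ← h2]
    ring

/-! ### A neighbour of the root of degree four -/

section deg_four
variable [Fintype V] {v u x y z : V} {α a b c : ZMod 2} {M R : Multiset (SEdge V)}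

/-- The obstruction by a labelling to pairing off the edges `uv`, `ux` and `uy`, `uz`. -/
def CostBad (M : Multiset (SEdge V)) (v u x y z : V) (α a b c : ZMod 2) : Prop :=
  ∃ s : V → SignType, s v = 1 ∧ s u = 0 ∧ act a (s x) = act α 1 ∧ act b (s y) = -act α 1 ∧
    act c (s z) = -act α 1 ∧ wt (cost s) M = 8

/-- The obstruction by a cut to pairing off the edges `uv`, `ux` and `uy`, `uz`. -/
def CutBad (R : Multiset (SEdge V)) (v u x y z : V) : Prop :=
  ∃ Z : Finset V, v ∉ Z ∧ u ∉ Z ∧ y ∈ Z ∧ z ∈ Z ∧ x ∉ Z ∧ wt (cut Z) R ≤ 2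

/-- The new multigraph does not meet u, so a cheap labelling of it can be tested in M with all three
labels at u, where the nonzero ones cost at least 8 by strictness. Only the pattern of `CostBad`
survives. Cuts are tested likewise with u inside and outside. -/
theorem isRooted_pairing (h : IsRooted v M) (hs : IsStrict v M)
    (hM : M = (s(u, v), α) ::ₘ (s(u, x), a) ::ₘ (s(u, y), b) ::ₘ (s(u, z), c) ::ₘ R)
    (hR : wt (deg u) R = 0) (huv : u ≠ v) (hx : x ≠ u) (hy : y ≠ u) (hz : z ≠ u)
    (hC : ¬ CostBad M v u x y z α a b c) (hD : ¬ CutBad R v u x y z) :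
    ∃ N, Red {v} M N ∧ IsRooted v N ∧ wt (deg u) N < wt (deg u) M := by
  let N := (s(v, x), α + a) ::ₘ (s(y, z), b + c) ::ₘ R
  have hred : Red {v} M N := by
    refine .tail (.single (b := (s(v, x), α + a) ::ₘ (s(u, y), b) ::ₘ (s(u, z), c) ::ₘ R) ?_) ?_
    · exact ⟨u, v, x, α, a, _, by simp [huv], by rw [hM, Sym2.eq_swap (a := v)], rfl⟩
    · refine ⟨u, y, z, b, c, (s(v, x), α + a) ::ₘ R, by simp [huv], ?_, ?_⟩
      · rw [Sym2.eq_swap (a := y), Multiset.cons_swap _ (s(v, x), α + a),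
          Multiset.cons_swap _ (s(v, x), α + a)]
      · rw [Multiset.cons_swap]
  have hudeg : 0 < wt (deg u) M := by rw [hM]; simp
  refine ⟨N, hred, h.of_red hred (fun s hsv => ?_) fun Z hvZ hZ => ?_, by
    simp [hM, N, hx, hy, hz, huv.symm, hR]⟩
  · by_contra hlt
    have hev := even_cost s fun w => hred.even_deg (h.even w)
    have hcost : ∀ t, wt (cost (Function.update s u t)) M = gap t (act α 1) +
        (gap t (act a (s x)) + (gap t (act b (s y)) + (gap t (act c (s z)) + wt (cost s) R))) := by
      intro t
      have : wt (cost (Function.update s u t)) R = wt (cost s) R := by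
        refine cost_congr fun w hw => ?_
        have : w ≠ u := by rintro rfl; omega
        simp [this]
      rw [hM]
      simp [this, hx, hy, hz, huv.symm, hsv]
    have hge : ∀ t, 6 ≤ wt (cost (Function.update s u t)) M := fun t =>
      h.cost_ge _ (by simp [huv.symm, hsv])
    have hge8 : ∀ t, t ≠ 0 → 8 ≤ wt (cost (Function.update s u t)) M := fun t ht =>
      hs _ (by simp [huv.symm, hsv]) ⟨u, huv, hudeg, by simpa using ht⟩
    have h0 := hge 0
    have h1 := hge8 1 (by decide)
    have h2 := hge8 (-1) (by decide)
    have hbad : ¬ (act a (s x) = act α 1 ∧ act b (s y) = -act α 1 ∧ act c (s z) = -act α 1 ∧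
        wt (cost (Function.update s u 0)) M = 8) := by
      rintro ⟨h3, h4, h5, h6⟩
      exact hC ⟨Function.update s u 0, by simp [huv.symm, hsv], by simp, by simpa [hx] using h3,
        by simpa [hy] using h4, by simpa [hz] using h5, h6⟩
    rw [hcost] at h0 h1 h2 hbad
    have hN : wt (cost s) N = gap (act α 1) (act a (s x)) + (gap (act b (s y)) (act c (s z)) +
        wt (cost s) R) := by
      simp only [N, wt_cons, cost_mk, act_add, hsv]
      congr 1
      · exact (by decide : ∀ α q, gap 1 (act α q) = gap (act α 1) q) _ _
      · congr 1
        exact (by decide : ∀ b c p q, gap p (act b (act c q)) = gap (act b p) (act c q)) _ _ _ _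
    rw [hN] at hlt hev
    have hε := act_one α
    clear_value N
    clear hC hD hred hcost hge hge8 hN
    revert hbad h0 h1 h2 hlt hev hε
    generalize act α 1 = ε
    generalize act a (s x) = p
    generalize act b (s y) = q
    generalize act c (s z) = r
    generalize wt (cost s) R = m
    rintro hlt ⟨k, hk⟩ h0 h1 h2 hbad (rfl | rfl) <;> cases p <;> cases q <;> cases r <;>
      simp [gap] at hbad h0 h1 h2 hlt hk <;> omega
  · by_contra hlt
    have hev := even_cut Z fun w => hred.even_deg (h.even w)
    have hwlog : wt (cut (Z.erase u)) N = wt (cut Z) N := by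
      refine cut_congr fun w hw => ?_
      have : w ≠ u := by
        rintro rfl
        simp [N, hx, hy, hz, huv.symm, hR] at hw
      simp [this]
    have hRe : ∀ Z, u ∉ Z → wt (cut (insert u Z)) R = wt (cut Z) R := fun Z hZ => by
      refine cut_congr fun w hw => ?_
      have : w ≠ u := by rintro rfl; omega
      simp [this]
    obtain ⟨w, hw, hdw⟩ := hZ
    have hwu : w ≠ u := by
      rintro rfl
      simp [N, hx, hy, hz, huv.symm, hR] at hdw
    rw [← hwlog] at hlt hev
    have hwZ : w ∈ Z.erase u := by simp [hw, hwu]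
    have hvZ' : v ∉ Z.erase u := by simp [hvZ]
    have huZ' : u ∉ Z.erase u := by simp
    generalize Z.erase u = Z' at *
    have hdM := lt_of_lt_of_le hdw (hred.deg_le w)
    have h1 := h.cut_ge Z' hvZ' ⟨w, hwZ, hdM⟩
    have h2 := h.cut_ge (insert u Z') (by simp [hvZ', huv.symm]) ⟨u, by simp, hudeg⟩
    have h3 : ¬ (y ∈ Z' ∧ z ∈ Z' ∧ x ∉ Z' ∧ wt (cut Z') R ≤ 2) := fun h3 =>
      hD ⟨Z', hvZ', huZ', h3⟩
    rw [hM] at h1 h2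
    simp only [wt_cons, cut_mk, N, Finset.mem_insert, hRe _ huZ', hx, hy, hz, huv.symm, hvZ',
      huZ', false_or, true_or] at h1 h2 hlt hev
    obtain ⟨k, hk⟩ := hev
    by_cases hx' : x ∈ Z' <;> by_cases hy' : y ∈ Z' <;> by_cases hz' : z ∈ Z' <;>
      simp [hx', hy', hz'] at h1 h2 h3 hlt hk <;> omega

/-- Z ∩ Z' and Z ∪ Z' ∪ {u} each have only one star edge on their boundary, hence at least three
edges of R each, while submodularity allows four in all. -/
theorem not_cutBad_cutBad (h : IsRooted v M)
    (hM : M = (s(u, v), α) ::ₘ (s(u, x), a) ::ₘ (s(u, y), b) ::ₘ (s(u, z), c) ::ₘ R)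
    (hR : wt (deg u) R = 0) (huv : u ≠ v) (hx : x ≠ u) (hy : y ≠ u) (hz : z ≠ u)
    (h₁ : CutBad R v u x y z) : ¬ CutBad R v u y x z := by
  obtain ⟨Z, hv, hu, hyZ, hzZ, hxZ, hc⟩ := h₁
  rintro ⟨Z', hv', hu', hxZ', hzZ', hyZ', hc'⟩
  have hdz : 0 < wt (deg z) M := by rw [hM]; simp
  have hdu : 0 < wt (deg u) M := by rw [hM]; simp
  have h1 := h.cut_ge (Z ∩ Z') (by simp [hv]) ⟨z, by simp [hzZ, hzZ'], hdz⟩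
  have h2 := h.cut_ge (insert u (Z ∪ Z')) (by simp [hv, hv', huv.symm]) ⟨u, by simp, hdu⟩
  have hRe : wt (cut (insert u (Z ∪ Z'))) R = wt (cut (Z ∪ Z')) R := by
    refine cut_congr fun w hw => ?_
    have : w ≠ u := by rintro rfl; omega
    simp [this]
  have h3 := cut_inter_union Z Z' R
  rw [hM] at h1 h2
  simp [hv, hu, hv', hu', hyZ, hzZ, hxZ, hxZ', hyZ', hzZ', huv.symm, hRe] at h1 h2
  omega

/-- Uncrossing makes the two labellings opposite off v, so u is the only nonisolated vertex with
label 0. The edges away from u then cost 4, and the parity of half that cost makes the total sign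
even. -/
theorem not_costBad_costBad (h : IsRooted v M) (hs : IsStrict v M)
    (hM : M = (s(u, v), α) ::ₘ (s(u, x), a) ::ₘ (s(u, y), b) ::ₘ (s(u, z), c) ::ₘ R)
    (hR : wt (deg u) R = 0) (huv : u ≠ v) (hx : x ≠ u) (hy : y ≠ u) (hz : z ≠ u)
    (h₁ : CostBad M v u x y z α a b c) : ¬ CostBad M v u y x z α b a c := by
  obtain ⟨s, hsv, hsu, hsx, hsy, hsz, hcs⟩ := h₁
  rintro ⟨t, htv, htu, hty, htx, htz, hct⟩
  have hε := act_one α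
  have hdu : 0 < wt (deg u) M := by rw [hM]; simp
  -- Each labelling spends 4 at u and hence 4 on R; meet and join spend only 2 each at u, which
  -- gives at most 8 + 4 = 12.
  have hopp := trivial_of_meet_join h hs hsv htv (by
    have h1 := cost_meet_join s t R
    rw [hM] at hcs hct ⊢
    simp only [wt_cons, cost_mk, hsu, htu, hsv, htv, act_meet, act_join, hsx, hsy, hsz, htx, hty,
      htz] at hcs hct ⊢
    revert h1 hcs hct
    generalize wt (cost fun x => meet (s x) (t x)) R = m₁
    generalize wt (cost fun x => join (s x) (t x)) R = m₂
    intro h1 hcs hct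
    rcases hε with h | h <;> rw [h] at hcs hct ⊢ <;> simp [gap, meet, join] at hcs hct ⊢ <;> omega)
  have hne : ∀ a (w : V), act a (s w) = act α 1 ∨ act a (s w) = -act α 1 → s w ≠ 0 := by
    intro a w h h0
    rw [h0, act_self_zero] at h
    revert h; clear * -; revert α; decide
  have hsx0 := hne a x (.inl hsx)
  have hsy0 := hne b y (.inr hsy)
  have hsz0 := hne c z (.inr hsz)
  have hxv : x ≠ v := by
    rintro rfl
    rw [hsv] at hsx; rw [htv, hsx] at htx
    rcases hε with h | h <;> rw [h] at htx <;> exact absurd htx (by decide)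
  have hnz := ne_zero_of_opposite h huv hdu hsv htv hsu (by omega) hopp
    (.inl ⟨x, hxv, by rw [hM]; simp, hsx0⟩) (by
      intro w d hw
      rw [hM] at hw
      simp only [Multiset.mem_cons, Prod.mk.injEq, Sym2.eq_iff] at hw
      by_cases hwu : w = u
      · exact .inl hwu
      right
      rcases hw with hw | hw | hw | hw | hw
      · have : w = v := by tauto
        simp [this, hsv]
      · have : w = x := by tauto
        simpa [this] using hsx0
      · have : w = y := by tauto
        simpa [this] using hsy0
      · have : w = z := by tauto
        simpa [this] using hsz0
      · have := wt_eq_zero.1 hR _ hw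
        simp at this)
  obtain ⟨m, h1, h2⟩ := cost_eq_two_mul (s := s) (R := R) (by
    intro w hw
    refine hnz w (by rintro rfl; omega) ?_
    rw [hM]; simp; omega)
  have h3 := wt_ends_eq_zero (fun w => neg1 (s w)) h.even
  have h4 := h.odd
  rw [hM] at hcs h3 h4
  simp only [wt_cons, cost_mk, ends_mk, hsu, hsv, hsx, hsy, hsz] at hcs h3 h4
  have hm : m = 2 := by
    rcases hε with h | h <;> rw [h] at hcs <;> simp [gap] at hcs <;> omega
  rw [hm] at h2
  have key : ∀ a p, p ≠ 0 → a = neg1 p + neg1 (act a p) := by decide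
  have ka := key a _ hsx0
  have kb := key b _ hsy0
  have kc := key c _ hsz0
  rw [hsx] at ka
  rw [hsy] at kb
  rw [hsz] at kc
  have k0 : ∀ α : ZMod 2, α + neg1 (act α 1) + neg1 (-act α 1) + neg1 (-act α 1) = 0 := by decide
  have k1 : neg1 0 = 0 := by decide
  have k2 : neg1 1 = 0 := by decide
  rw [k1, k2] at h3
  have hR' : wt Prod.snd R = wt (ends fun w => neg1 (s w)) R := by
    have : ((2 : ℕ) : ZMod 2) = 0 := by decide
    rw [this] at h2
    exact (CharTwo.add_eq_zero).1 h2
  rw [ka, kb, kc, hR'] at h4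
  have : (1 : ZMod 2) = 0 := by
    rw [← h4]
    linear_combination h3 + k0 α
  exact absurd this (by decide)

/-- There are three pairings of the four edges but only two kinds of obstruction, and no kind can
occur for two pairings. -/
theorem exists_red_of_deg_four (h : IsRooted v M) (hs : IsStrict v M)
    (hM : M = (s(u, v), α) ::ₘ (s(u, x), a) ::ₘ (s(u, y), b) ::ₘ (s(u, z), c) ::ₘ R)
    (hR : wt (deg u) R = 0) (huv : u ≠ v) (hx : x ≠ u) (hy : y ≠ u) (hz : z ≠ u) :
    ∃ N, Red {v} M N ∧ IsRooted v N ∧ wt (deg u) N < wt (deg u) M := by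
  by_contra hcon
  have hsymC : ∀ {x y z a b c}, CostBad M v u x y z α a b c → CostBad M v u x z y α a c b := by
    rintro x y z a b c ⟨s, h1, h2, h3, h4, h5, h6⟩
    exact ⟨s, h1, h2, h3, h5, h4, h6⟩
  have hsymD : ∀ {x y z}, CutBad R v u x y z → CutBad R v u x z y := by
    rintro x y z ⟨Z, h1, h2, h3, h4, h5⟩
    exact ⟨Z, h1, h2, h4, h3, h5⟩
  have hM₂ : M = (s(u, v), α) ::ₘ (s(u, y), b) ::ₘ (s(u, x), a) ::ₘ (s(u, z), c) ::ₘ R := by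
    rw [hM, Multiset.cons_swap (s(u, x), a)]
  have hM₃ : M = (s(u, v), α) ::ₘ (s(u, z), c) ::ₘ (s(u, x), a) ::ₘ (s(u, y), b) ::ₘ R := by
    rw [hM, Multiset.cons_swap (s(u, y), b), Multiset.cons_swap (s(u, x), a)]
  have hM₄ : M = (s(u, v), α) ::ₘ (s(u, x), a) ::ₘ (s(u, z), c) ::ₘ (s(u, y), b) ::ₘ R := by
    rw [hM, Multiset.cons_swap (s(u, y), b)]
  have hM₅ : M = (s(u, v), α) ::ₘ (s(u, y), b) ::ₘ (s(u, z), c) ::ₘ (s(u, x), a) ::ₘ R := by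
    rw [hM₂, Multiset.cons_swap (s(u, x), a)]
  have h1 : CostBad M v u x y z α a b c ∨ CutBad R v u x y z := by
    by_contra! H
    exact hcon (isRooted_pairing h hs hM hR huv hx hy hz H.1 H.2)
  have h2 : CostBad M v u y x z α b a c ∨ CutBad R v u y x z := by
    by_contra! H
    exact hcon (isRooted_pairing h hs hM₂ hR huv hy hx hz H.1 H.2)
  have h3 : CostBad M v u z x y α c a b ∨ CutBad R v u z x y := by
    by_contra! H
    exact hcon (isRooted_pairing h hs hM₃ hR huv hz hx hy H.1 H.2)
  have c12 := not_costBad_costBad h hs hM hR huv hx hy hz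
  have d12 := not_cutBad_cutBad h hM hR huv hx hy hz
  have c13 := not_costBad_costBad h hs hM₄ hR huv hx hz hy
  have d13 := not_cutBad_cutBad h hM₄ hR huv hx hz hy
  have c23 := not_costBad_costBad h hs hM₅ hR huv hy hz hx
  have d23 := not_cutBad_cutBad h hM₅ hR huv hy hz hx
  rcases h1 with h1 | h1 <;> rcases h2 with h2 | h2 <;> rcases h3 with h3 | h3 <;>
    first
    | exact c12 h1 h2
    | exact d12 h1 h2
    | exact c13 (hsymC h1) h3
    | exact d13 (hsymD h1) h3
    | exact c23 (hsymC h2) (hsymC h3)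
    | exact d23 (hsymD h2) (hsymD h3)

end deg_four

/-! ### A neighbour of the root with a loop -/

section loop
variable [Fintype V] {v u x y z : V} {α a b c l : ZMod 2} {M R : Multiset (SEdge V)}

/-- A labelling that obstructs merging an odd loop at `u` with the edge `uw`. -/
def LoopBad (M : Multiset (SEdge V)) (v u w : V) (d : ZMod 2) : Prop :=
  ∃ s : V → SignType, s v = 1 ∧ s u ≠ 0 ∧ act d (s w) = -s u ∧ wt (cost s) M = 8

/-- Merging an even loop changes no cost, and cuts do not see loops. Merging an odd loop loses at
most 2 when u has a nonzero label, which strictness permits, except for the pattern of `LoopBad`,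
which loses 4. -/
theorem merge_loop (h : IsRooted v M) (hs : IsStrict v M) {w : V} {d : ZMod 2}
    (hM : M = (s(u, w), d) ::ₘ (s(u, u), l) ::ₘ R) (huv : u ≠ v) (hw : w ≠ u)
    (hbad : l = 1 → ¬ LoopBad M v u w d) :
    ∃ N, Red {v} M N ∧ IsRooted v N ∧ wt (deg u) N < wt (deg u) M := by
  have hstep : Step {v} M ((s(w, u), d + l) ::ₘ R) :=
    ⟨u, w, u, d, l, R, by simp [huv], by rw [hM, Sym2.eq_swap (a := w)], rfl⟩
  have hred : Red {v} M ((s(w, u), d + l) ::ₘ R) := .single hstep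
  refine ⟨_, hred, h.of_red hred (fun s hsv => ?_) (fun Z hvZ hZ => ?_), by simp [hM, hw]⟩
  · by_contra hlt
    have hev := even_cost s fun w => hred.even_deg (h.even w)
    have h6 := h.cost_ge s hsv
    have h8 : s u ≠ 0 → 8 ≤ wt (cost s) M := fun h0 =>
      hs s hsv ⟨u, huv, by rw [hM]; simp, h0⟩
    have hb : l = 1 → s u ≠ 0 → act d (s w) = -s u → wt (cost s) M ≠ 8 := fun h1 h2 h3 h4 =>
      hbad h1 ⟨s, hsv, h2, h3, h4⟩
    have hl : l = 0 ∨ l = 1 := (by decide : ∀ l : ZMod 2, l = 0 ∨ l = 1) l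
    have e : gap (s w) (act (d + l) (s u)) = gap (act d (s w)) (act l (s u)) :=
      (by decide : ∀ d l p q, gap p (act (d + l) q) = gap (act d p) (act l q)) _ _ _ _
    rw [hM] at h6 h8 hb
    simp only [wt_cons, cost_mk, e] at h6 h8 hb hlt hev
    clear hbad hM hred hstep e
    obtain ⟨k, hk⟩ := hev
    generalize s u = p at *
    generalize act d (s w) = q at *
    generalize wt (cost s) R = m at *
    rcases hl with rfl | rfl <;> cases p <;> cases q <;> simp [gap, act] at * <;> omega
  · obtain ⟨w', hw', hd⟩ := hZ
    have := h.cut_ge Z hvZ ⟨w', hw', lt_of_lt_of_le hd (hred.deg_le _)⟩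
    rw [hM] at this
    simpa [iff_comm] using this

theorem cost_update (hM : M = (s(u, v), α) ::ₘ (s(u, x), a) ::ₘ (s(u, y), b) ::ₘ (s(u, z), c) ::ₘ
      (s(u, u), 1) ::ₘ R) (hR : wt (deg u) R = 0) (huv : u ≠ v) (hx : x ≠ u) (hy : y ≠ u)
    (hz : z ≠ u) {s : V → SignType} (hsv : s v = 1) (t : SignType) :
    wt (cost (Function.update s u t)) M = gap t (act α 1) + (gap t (act a (s x)) +
      (gap t (act b (s y)) + (gap t (act c (s z)) + (gap t (-t) + wt (cost s) R)))) := by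
  have : wt (cost (Function.update s u t)) R = wt (cost s) R := by
    refine cost_congr fun w hw => ?_
    have : w ≠ u := by rintro rfl; omega
    simp [this]
  rw [hM]
  simp [this, hx, hy, hz, huv.symm, hsv, act]

/-- The parity argument again, for a labelling zero only at u: the odd loop then costs nothing but
still counts in the total sign. -/
theorem even_of_ne_zero (h : IsRooted v M) (hM : M = (s(u, v), α) ::ₘ (s(u, x), a) ::ₘ
      (s(u, y), b) ::ₘ (s(u, z), c) ::ₘ (s(u, u), 1) ::ₘ R)
    (hR : wt (deg u) R = 0) {s : V → SignType} (hsv : s v = 1) (hsu : s u = 0)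
    (hnz : ∀ w, w ≠ u → 0 < wt (deg w) M → s w ≠ 0) (hx : x ≠ u) (hy : y ≠ u) (hz : z ≠ u)
    {m : ℕ} (hm : wt (cost s) M = 4 + 2 * m)
    (hpar : (m : ZMod 2) + neg1 (act α 1) + neg1 (act a (s x)) + neg1 (act b (s y)) +
      neg1 (act c (s z)) = 1) : False := by
  obtain ⟨m', h1, h2⟩ := cost_eq_two_mul (s := s) (R := R) (by
    intro w hw
    refine hnz w (by rintro rfl; omega) ?_
    rw [hM]; simp; omega)
  have h3 := wt_ends_eq_zero (fun w => neg1 (s w)) h.even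
  have h4 := h.odd
  have hsx0 := hnz x hx (by rw [hM]; simp)
  have hsy0 := hnz y hy (by rw [hM]; simp)
  have hsz0 := hnz z hz (by rw [hM]; simp)
  have k0 : ∀ a p, p ≠ 0 → gap 0 (act a p) = 1 := by decide
  have k00 : ∀ a, gap 0 (act a 0) = 0 := by decide
  rw [hM] at hm h3 h4
  simp only [wt_cons, cost_mk, ends_mk, hsu, hsv, k00, k0 _ _ hsx0, k0 _ _ hsy0, k0 _ _ hsz0,
    k0 α 1 (by decide)] at hm h3 h4
  obtain rfl : m' = m := by omega
  have key : ∀ a p, p ≠ 0 → neg1 (act a p) = a + neg1 p := by decide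
  rw [key _ _ hsx0, key _ _ hsy0, key _ _ hsz0, key α 1 (by decide)] at hpar
  have k1 : neg1 0 = 0 := by decide
  rw [k1] at h3
  have : (1 : ZMod 2) = 0 := by
    linear_combination h4 + h3 - hpar - h2
  exact absurd this (by decide)

/-- Relabelling u by 0 gives cost 6, so by strictness the labelling is trivial and z = v. Taken as
its own opposite, it satisfies `ne_zero_of_opposite`, and parity gives the contradiction. -/
theorem false_of_loopBad_parallel (h : IsRooted v M) (hs : IsStrict v M)
    (hM : M = (s(u, v), α) ::ₘ (s(u, v), a) ::ₘ (s(u, v), b) ::ₘ (s(u, z), c) ::ₘ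
      (s(u, u), 1) ::ₘ R)
    (hR : wt (deg u) R = 0) (huv : u ≠ v) (hz : z ≠ u)
    (ha : act a 1 = -act α 1) (hb : act b 1 = -act α 1) (hbad : LoopBad M v u v a) : False := by
  obtain ⟨t, htv, htu, htx, hct⟩ := hbad
  have hdu : 0 < wt (deg u) M := by rw [hM]; simp
  rw [htv, ha, neg_inj] at htx
  have hc := cost_update hM hR huv huv.symm huv.symm hz htv
  have h0 := h.cost_ge (Function.update t u 0) (by simp [huv.symm, htv])
  have hself : Function.update t u (t u) = t := by simp
  have h8 := hc (t u)
  rw [hself, hct, ← htx] at h8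
  rw [hc] at h0
  rw [htv, ha, hb] at h8 h0
  have hε := act_one α
  have key : act c (t z) = act α 1 ∧ wt (cost t) R = 2 := by
    revert h8 h0
    generalize act c (t z) = r
    generalize act α 1 = ε at *
    rcases hε with rfl | rfl <;> cases r <;> simp [gap] <;> omega
  have hc6 : wt (cost (Function.update t u 0)) M = 6 := by
    rw [hc, htv, ha, hb, key.1, key.2]
    rcases hε with h | h <;> rw [h] <;> simp [gap]
  have htriv : ∀ w, w ≠ v → w ≠ u → 0 < wt (deg w) M → t w = 0 := by
    intro w hwv hwu hw
    by_contra hne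
    have := hs (Function.update t u 0) (by simp [huv.symm, htv]) ⟨w, hwv, hw, by simpa [hwu]⟩
    omega
  have hzv : z = v := by
    by_contra hzv
    have := htriv z hzv hz (by rw [hM]; simp)
    rw [this, act_self_zero] at key
    rcases hε with h | h <;> rw [h] at key <;> exact absurd key.1 (by decide)
  have hnz := ne_zero_of_opposite (s := Function.update t u 0) (t := Function.update t u 0) h huv
    hdu (by simp [huv.symm, htv]) (by simp [huv.symm, htv]) (by simp) (by omega) (by
      intro w hwv hw
      by_cases hwu : w = u
      · simp [hwu]
      · simp [hwu, htriv w hwv hwu hw]) (.inr (by omega)) (by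
      intro w d hw
      rw [hM] at hw
      simp only [Multiset.mem_cons, Prod.mk.injEq, Sym2.eq_iff] at hw
      by_cases hwu : w = u
      · exact .inl hwu
      right
      rcases hw with hw | hw | hw | hw | hw | hw
      · have : w = v := by subst hzv; tauto
        simp [this, htv, huv.symm]
      · have : w = v := by subst hzv; tauto
        simp [this, htv, huv.symm]
      · have : w = v := by subst hzv; tauto
        simp [this, htv, huv.symm]
      · have : w = v := by subst hzv; tauto
        simp [this, htv, huv.symm]
      · tauto
      · have := wt_eq_zero.1 hR _ hw
        simp at this)
  refine even_of_ne_zero (m := 1) h hM hR (by simp [huv.symm, htv]) (by simp) hnz huv.symm huv.symm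
    hz (by omega) ?_
  rw [Function.update_of_ne huv.symm, Function.update_of_ne hz, key.1, htv, ha, hb]
  rcases hε with h | h <;> rw [h] <;> decide

/-- Merging the loop with each edge at u is obstructed. Relabelling u by 0 in an obstruction costs 6
or 8. Cost 6 means triviality and forces parallel edges to v; cost 8 for two obstructions makes them
opposite off v. -/
theorem exists_red_of_loop (h : IsRooted v M) (hs : IsStrict v M)
    (hM : M = (s(u, v), α) ::ₘ (s(u, x), a) ::ₘ (s(u, y), b) ::ₘ (s(u, z), c) ::ₘ
      (s(u, u), l) ::ₘ R)
    (hR : wt (deg u) R = 0) (huv : u ≠ v) (hx : x ≠ u) (hy : y ≠ u) (hz : z ≠ u) :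
    ∃ N, Red {v} M N ∧ IsRooted v N ∧ wt (deg u) N < wt (deg u) M := by
  by_contra hcon
  have hbad : ∀ {w d R'}, w ≠ u → M = (s(u, w), d) ::ₘ (s(u, u), l) ::ₘ R' →
      l = 1 ∧ LoopBad M v u w d := by
    intro w d R' hw hM'
    by_contra! H
    exact hcon (merge_loop h hs hM' huv hw H)
  have hMv : M = (s(u, v), α) ::ₘ (s(u, u), l) ::ₘ (s(u, x), a) ::ₘ (s(u, y), b) ::ₘ
      (s(u, z), c) ::ₘ R := by
    rw [hM, Multiset.cons_swap _ (s(u, u), l), Multiset.cons_swap _ (s(u, u), l),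
      Multiset.cons_swap _ (s(u, u), l)]
  have hMx : M = (s(u, x), a) ::ₘ (s(u, u), l) ::ₘ (s(u, v), α) ::ₘ (s(u, y), b) ::ₘ
      (s(u, z), c) ::ₘ R := by
    rw [hMv, Multiset.cons_swap _ (s(u, x), a), Multiset.cons_swap _ (s(u, x), a),
      Multiset.cons_swap (s(u, v), α)]
  have hMy : M = (s(u, y), b) ::ₘ (s(u, u), l) ::ₘ (s(u, v), α) ::ₘ (s(u, x), a) ::ₘ
      (s(u, z), c) ::ₘ R := by
    rw [hMv, Multiset.cons_swap _ (s(u, y), b), Multiset.cons_swap _ (s(u, y), b),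
      Multiset.cons_swap _ (s(u, y), b), Multiset.cons_swap (s(u, v), α)]
  obtain ⟨hl, s, hsv, hsu, hsε, hcs⟩ := hbad huv.symm hMv
  subst hl
  have hbx := (hbad hx hMx).2
  have hby := (hbad hy hMy).2
  have hε := act_one α
  have hdu : 0 < wt (deg u) M := by rw [hM]; simp
  have hsu' : s u = -act α 1 := by rw [hsv] at hsε; rw [hsε, neg_neg]
  have hcost := fun {s : V → SignType} (hsv : s v = 1) =>
    cost_update hM hR huv hx hy hz hsv
  have htriv : ∀ {s : V → SignType}, s v = 1 → wt (cost (Function.update s u 0)) M < 8 →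
      ∀ w, w ≠ u → 0 < wt (deg w) M → s w ≠ 0 → w = v := by
    intro s hsv hlt w hwu hw hsw
    by_contra hwv
    have := hs (Function.update s u 0) (by simp [huv.symm, hsv]) ⟨w, hwv, hw, by simpa [hwu]⟩
    omega
  have hne : ∀ {s : V → SignType} {a : ZMod 2} {w : V},
      act a (s w) = act α 1 ∨ act a (s w) = -act α 1 → s w ≠ 0 := by
    intro s a w h h0
    rw [h0, act_self_zero] at h
    revert h; clear * -; revert α; decide
  have hge : ∀ {s : V → SignType}, s v = 1 → 6 ≤ wt (cost (Function.update s u 0)) M := fun hsv =>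
    h.cost_ge _ (by simp [huv.symm, hsv])
  have hdx : 0 < wt (deg x) M := by rw [hM]; simp
  have hdy : 0 < wt (deg y) M := by rw [hM]; simp
  have hdz : 0 < wt (deg z) M := by rw [hM]; simp
  -- the shape of `s` at `u`
  have hshape : (act a (s x) = -act α 1 ∧ act b (s y) = -act α 1 ∧ act c (s z) = -act α 1 ∧
      wt (cost (Function.update s u 0)) M = 8) ∨
      (wt (cost (Function.update s u 0)) M = 6 ∧
      ((act a (s x) = -act α 1 ∧ act b (s y) = -act α 1) ∨
      (act a (s x) = -act α 1 ∧ act c (s z) = -act α 1) ∨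
      (act b (s y) = -act α 1 ∧ act c (s z) = -act α 1))) := by
    have h8 := hcost hsv (s u)
    have h0 := hge hsv
    rw [show Function.update s u (s u) = s by simp, hcs, hsu'] at h8
    rw [hcost hsv] at h0 ⊢
    clear * - h8 h0 hε
    revert h8 h0
    generalize act a (s x) = p
    generalize act b (s y) = q
    generalize act c (s z) = r
    generalize act α 1 = ε at *
    rcases hε with rfl | rfl <;> cases p <;> cases q <;> cases r <;> simp [gap] <;> omega
  rcases hshape with ⟨hsx, hsy, hsz, hc8⟩ | ⟨hc6, hpair⟩
  · obtain ⟨t, htv, htu, htx, hct⟩ := hbx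
    -- the shape of `t` at `u`
    have hshape : (wt (cost (Function.update t u 0)) M = 8 ∧ act a (t x) = -act α 1 ∧
        act b (t y) = act α 1 ∧ act c (t z) = act α 1) ∨
        (wt (cost (Function.update t u 0)) M = 6 ∧ (act a (t x) = act α 1 ∨
          act b (t y) = act α 1 ∨ act c (t z) = act α 1)) := by
      have h8 := hcost htv (t u)
      have h0 := hge htv
      rw [show Function.update t u (t u) = t by simp, hct] at h8
      rw [hcost htv] at h0 ⊢
      clear * - h8 h0 hε htu htx
      revert h8 h0 htu htx
      generalize t u = w
      generalize act a (t x) = p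
      generalize act b (t y) = q
      generalize act c (t z) = r
      generalize act α 1 = ε at *
      rintro hw rfl
      rcases hε with rfl | rfl <;> cases w <;> cases q <;> cases r <;> simp [gap] at * <;> omega
    -- Cost 6 makes t trivial once u is relabelled, so w = v, where s and t agree.
    have hcl : ∀ {w d}, w ≠ u → 0 < wt (deg w) M → act d (s w) = -act α 1 →
        act d (t w) = act α 1 → wt (cost (Function.update t u 0)) M = 6 → False := by
      intro w d hwu hw h1 h2 h3
      obtain rfl := htriv htv (by omega) w hwu hw (hne (.inl h2))
      rw [htv] at h2; rw [hsv, h2] at h1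
      rcases hε with h | h <;> rw [h] at h1 <;> exact absurd h1 (by decide)
    rcases hshape with ⟨hct8, htx, hty, htz⟩ | ⟨hct6, h1 | h1 | h1⟩
    · obtain ⟨s', hs'⟩ : ∃ s', s' = Function.update s u 0 := ⟨_, rfl⟩
      obtain ⟨t', ht'⟩ : ∃ t', t' = Function.update t u 0 := ⟨_, rfl⟩
      rw [← hs'] at hc8
      rw [← ht'] at hct8
      have hsw : ∀ w, w ≠ u → s' w = s w := fun w hw => by simp [hs', hw]
      have htw : ∀ w, w ≠ u → t' w = t w := fun w hw => by simp [ht', hw]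
      rw [← hsw v huv.symm] at hsv
      rw [← hsw x hx] at hsx
      rw [← hsw y hy] at hsy
      rw [← hsw z hz] at hsz
      rw [← htw v huv.symm] at htv
      rw [← htw x hx] at htx
      rw [← htw y hy] at hty
      rw [← htw z hz] at htz
      have hsu0 : s' u = 0 := by simp [hs']
      have htu0 : t' u = 0 := by simp [ht']
      clear hs' ht' hsw htw
      have hopp := trivial_of_meet_join h hs hsv htv (by
        have h1 := cost_meet_join s' t' R
        have hmj : meet 0 0 = 0 ∧ join 0 0 = 0 := by decide
        rw [hM] at hc8 hct8 ⊢
        simp only [wt_cons, cost_mk, hsu0, htu0, hsv, htv, act_meet, act_join, hsx, hsy, hsz, htx,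
          hty, htz, hmj.1, hmj.2, act_self_zero] at hc8 hct8 ⊢
        revert h1 hc8 hct8
        generalize wt (cost fun x => meet (s' x) (t' x)) R = m₁
        generalize wt (cost fun x => join (s' x) (t' x)) R = m₂
        intro h1 hcs hct
        rcases hε with h | h <;> rw [h] at hcs hct ⊢ <;> simp [gap, meet, join] at hcs hct ⊢ <;>
          omega)
      have hsy0 := hne (.inr hsy)
      have hyv : y ≠ v := by
        rintro rfl
        rw [hsv] at hsy; rw [htv, hsy] at hty
        rcases hε with h | h <;> rw [h] at hty <;> exact absurd hty (by decide)
      have hnz := ne_zero_of_opposite h huv hdu hsv htv hsu0 (by omega) hopp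
        (.inl ⟨y, hyv, hdy, hsy0⟩) (by
          intro w d hw
          rw [hM] at hw
          simp only [Multiset.mem_cons, Prod.mk.injEq, Sym2.eq_iff] at hw
          by_cases hwu : w = u
          · exact .inl hwu
          right
          rcases hw with hw | hw | hw | hw | hw | hw
          · have : w = v := by tauto
            simp [this, hsv]
          · have : w = x := by tauto
            simpa [this] using hne (.inr hsx)
          · have : w = y := by tauto
            simpa [this] using hne (.inr hsy)
          · have : w = z := by tauto
            simpa [this] using hne (.inr hsz)
          · tauto
          · have := wt_eq_zero.1 hR _ hw
            simp at this)
      refine even_of_ne_zero (m := 2) h hM hR hsv hsu0 hnz hx hy hz (by omega) ?_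
      rw [hsx, hsy, hsz]
      rcases hε with h | h <;> rw [h] <;> decide
    · exact hcl hx hdx hsx h1 hct6
    · exact hcl hy hdy hsy h1 hct6
    · exact hcl hz hdz hsz h1 hct6
  -- Relabelling u by 0 makes s trivial, so the two neighbours in `hpair` are v itself, joined by
  -- edges of sign opposite to α.
  · have hcl : ∀ {w d}, w ≠ u → 0 < wt (deg w) M → act d (s w) = -act α 1 →
        w = v ∧ act d 1 = -act α 1 := by
      intro w d hwu hw h1
      have hwv := htriv hsv (by omega) w hwu hw (hne (.inr h1))
      exact ⟨hwv, by rwa [hwv, hsv] at h1⟩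
    rcases hpair with ⟨h1, h2⟩ | ⟨h1, h2⟩ | ⟨h1, h2⟩
    · obtain ⟨e1, e2⟩ := hcl hx hdx h1
      obtain ⟨e3, e4⟩ := hcl hy hdy h2
      rw [e1] at hbx
      exact false_of_loopBad_parallel h hs (by rw [hM, e1, e3]) hR huv hz e2 e4 hbx
    · obtain ⟨e1, e2⟩ := hcl hx hdx h1
      obtain ⟨e3, e4⟩ := hcl hz hdz h2
      rw [e1] at hbx
      exact false_of_loopBad_parallel h hs (by rw [hM, e1, e3, Multiset.cons_swap (s(u, y), b)])
        hR huv hy e2 e4 hbx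
    · obtain ⟨e1, e2⟩ := hcl hy hdy h1
      obtain ⟨e3, e4⟩ := hcl hz hdz h2
      rw [e1] at hby
      exact false_of_loopBad_parallel h hs (by
        rw [hM, e1, e3, Multiset.cons_swap (s(u, x), a), Multiset.cons_swap (s(u, x), a)])
        hR huv hx e2 e4 hby

end loop

/-! ### A neighbour of the root with six non-loop edges -/

section star
variable [Fintype V] {ι : Type*} [Fintype ι] [DecidableEq ι] {x : ι → V} {a : ι → ZMod 2}
  {v u : V} {M R : Multiset (SEdge V)}

/-- Splitting loses at most 4 from a labelling. A loss of 2 is fatal only at cost 6, hence for a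
trivial labelling, which gives the parallel edges. A loss of 4 is fatal up to cost 8 and needs the
labels of the last alternative. A cut loses at most 2. -/
theorem split_or_obstruction (h : IsRooted v M) (hs : IsStrict v M)
    (hM : M = Finset.univ.val.map (fun i => (s(u, x i), a i)) + R) (hxu : ∀ i, x i ≠ u)
    (huv : u ≠ v) {p j : ι} (hp : x p = v) (hpj : p ≠ j) :
    (∃ N, Red {v} M N ∧ IsRooted v N ∧ wt (deg u) N < wt (deg u) M) ∨
    (∃ Z : Finset V, v ∉ Z ∧ u ∈ Z ∧ wt (cut Z) M ≤ 4 ∧ x j ∉ Z) ∨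
    (x j = v ∧ a j = a p) ∨
    (∃ s : V → SignType, s v = 1 ∧ s u = -act (a p) 1 ∧ wt (cost s) M ≤ 8 ∧
      act (a j) (s (x j)) = act (a p) 1) := by
  have hdeg : ∀ i, 0 < wt (deg (x i)) M ∧ 0 < wt (deg u) M := fun i => by
    have : (s(u, x i), a i) ∈ M := by
      rw [hM, Multiset.mem_add]; exact .inl (Multiset.mem_map.2 ⟨i, by simp, rfl⟩)
    exact ⟨lt_of_lt_of_le (by simp) (le_wt (deg (x i)) this),
      lt_of_lt_of_le (by simp) (le_wt (deg u) this)⟩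
  obtain ⟨N, hstep, hN⟩ := star_split (S := {v}) (by simp [huv]) hM hpj
  have hred : Red {v} M N := .single hstep
  by_contra! hcon
  obtain ⟨hgood, hcut, htype, hcost⟩ := hcon
  have hdN : wt (deg u) N < wt (deg u) M := by
    have := hN (deg u)
    simp [hxu] at this
    omega
  refine (hgood N hred (h.of_red hred (fun s hsv => ?_) fun Z hvZ hZ => ?_)).not_gt hdN
  · by_contra hlt
    have hev := even_cost s fun w => hred.even_deg (h.even w)
    have hloss := hN (cost s)
    simp only [cost_mk, hp, hsv] at hloss
    have e : gap 1 (act (a p + a j) (s (x j))) = gap (act (a p) 1) (act (a j) (s (x j))) :=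
      (by decide : ∀ a b q, gap 1 (act (a + b) q) = gap (act a 1) (act b q)) _ _ _
    have hε := act_one (a p)
    rw [e] at hloss
    have h6 := h.cost_ge s hsv
    have h1 : s u = -act (a p) 1 → act (a j) (s (x j)) = act (a p) 1 →
        8 < wt (cost s) M := fun h1 h2 => by
      by_contra h3
      exact hcost s hsv h1 (by omega) h2
    have h2 : s u ≠ 0 → 8 ≤ wt (cost s) M := fun h2 =>
      hs s hsv ⟨u, huv, (hdeg j).2, h2⟩
    have h3 : act (a j) (s (x j)) = act (a p) 1 → 8 ≤ wt (cost s) M := fun h3 => by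
      have hne : s (x j) ≠ 0 := by
        intro h0
        rw [h0, act_self_zero] at h3
        rcases hε with h | h <;> rw [h] at h3 <;> exact absurd h3 (by decide)
      refine hs s hsv ⟨x j, fun hxj => ?_, (hdeg j).1, hne⟩
      refine htype hxj ?_
      rw [hxj, hsv] at h3
      exact (by decide : ∀ a b, act a 1 = act b 1 → a = b) _ _ h3
    clear e htype hcost hN hcut hgood
    obtain ⟨k, hk⟩ := hev
    generalize wt (cost s) M = m at *
    generalize wt (cost s) N = n at *
    generalize s u = q at *
    generalize act (a j) (s (x j)) = r at *
    generalize act (a p) 1 = ε at *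
    rcases hε with rfl | rfl <;> cases q <;> cases r <;> simp [gap] at * <;> omega
  · by_contra hlt
    have hev := even_cut Z fun w => hred.even_deg (h.even w)
    have hloss := hN (cut Z)
    simp only [cut_mk, hp, hvZ] at hloss
    obtain ⟨w, hw, hd⟩ := hZ
    have h4 := h.cut_ge Z hvZ ⟨w, hw, lt_of_lt_of_le hd (hred.deg_le _)⟩
    have hc := hcut Z hvZ
    obtain ⟨k, hk⟩ := hev
    by_cases hu : u ∈ Z <;> by_cases hj : x j ∈ Z <;> simp [hu, hj] at hloss hc <;> omega

/-- If four star edges left Z, exactly two would stay inside, and Z without u would have at most two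
boundary edges. -/
theorem card_cross_le_three (h : IsRooted v M)
    (hM : M = Finset.univ.val.map (fun i => (s(u, x i), a i)) + R) (hxu : ∀ i, x i ≠ u)
    (hR : wt (deg u) R = 0) (hι : Fintype.card ι = 6) {Z : Finset V} (hv : v ∉ Z) (hu : u ∈ Z)
    (hZ : wt (cut Z) M ≤ 4) {J : Finset ι} (hJ : ∀ j ∈ J, x j ∉ Z) : J.card ≤ 3 := by
  by_contra! hlt
  let K : Finset ι := {i | x i ∉ Z}
  have hJK : J ⊆ K := fun j hj => by simpa [K] using hJ j hj
  have h1 := Finset.card_le_card hJK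
  have h2 := card_cross_le hM hu (J := K) (by simp [K])
  have hK : K.card < (Finset.univ : Finset ι).card := by rw [Finset.card_univ]; omega
  obtain ⟨i, -, hi⟩ := Finset.exists_mem_notMem_of_card_lt_card hK
  have hiZ : x i ∈ Z := by simpa [K] using hi
  have hdi : 0 < wt (deg (x i)) M := by
    have : (s(u, x i), a i) ∈ M := by
      rw [hM, Multiset.mem_add]; exact .inl (Multiset.mem_map.2 ⟨i, by simp, rfl⟩)
    exact lt_of_lt_of_le (by simp) (le_wt (deg (x i)) this)
  have h3 := h.cut_ge (Z.erase u) (by simp [hv]) ⟨x i, by simp [hiZ, hxu], hdi⟩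
  have hRR : wt (cut (Z.erase u)) R = wt (cut Z) R := by
    refine cut_congr fun y hy => ?_
    have : y ≠ u := by rintro rfl; omega
    simp [this]
  rw [star_cut hM, hRR] at h3
  have h4 : ∑ i, (if (u ∈ Z.erase u ↔ x i ∈ Z.erase u) then 0 else 1) + K.card = 6 := by
    have hKc : K.card = ∑ i, if x i ∉ Z then 1 else 0 := Finset.card_filter _ _
    rw [← hι, ← Finset.card_univ, hKc, Finset.card_eq_sum_ones, ← Finset.sum_add_distrib]
    refine Finset.sum_congr rfl fun i _ => ?_
    by_cases h : x i ∈ Z <;> simp [h, hxu]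
  omega

/-- Obstructing cuts uncross by intersection and obstructing labellings by meet, so one cut and one
labelling serve all edges concerned. Without labellings, either all six edges leave a single small
cut or all six are parallel edges to v of equal sign; the latter would let u take a label at no
cost. -/
theorem card_opposite_eq_two (h : IsRooted v M) (hs : IsStrict v M)
    (hM : M = Finset.univ.val.map (fun i => (s(u, x i), a i)) + R) (hxu : ∀ i, x i ≠ u)
    (hR : wt (deg u) R = 0) (huv : u ≠ v) (hι : Fintype.card ι = 6) {p : ι} (hp : x p = v)
    (hcon : ¬ ∃ N, Red {v} M N ∧ IsRooted v N ∧ wt (deg u) N < wt (deg u) M) :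
    (∃ Z : Finset V, v ∉ Z ∧ u ∈ Z ∧ wt (cut Z) M ≤ 4) ∧
      (Finset.univ.filter fun i => x i = v ∧ a i ≠ a p).card = 2 := by
  classical
  have hbad := fun j (hj : p ≠ j) =>
    (split_or_obstruction h hs hM hxu huv hp hj).resolve_left hcon
  have hdeg : ∀ i, 0 < wt (deg (x i)) M ∧ 0 < wt (deg u) M := fun i => by
    have : (s(u, x i), a i) ∈ M := by
      rw [hM, Multiset.mem_add]; exact .inl (Multiset.mem_map.2 ⟨i, by simp, rfl⟩)
    exact ⟨lt_of_lt_of_le (by simp) (le_wt (deg (x i)) this),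
      lt_of_lt_of_le (by simp) (le_wt (deg u) this)⟩
  have hε := act_one (a p)
  let P₂ : Finset V → Prop := fun Z => v ∉ Z ∧ u ∈ Z ∧ wt (cut Z) M ≤ 4
  let P₃ : (V → SignType) → Prop := fun s => s v = 1 ∧ s u = -act (a p) 1 ∧ wt (cost s) M ≤ 8
  have hall₂ : ∀ J : Finset ι, J.Nonempty → (∀ j ∈ J, ∃ Z, P₂ Z ∧ x j ∉ Z) →
      ∃ Z, P₂ Z ∧ ∀ j ∈ J, x j ∉ Z := by
    intro J hJ
    induction hJ using Finset.Nonempty.cons_induction with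
    | singleton j => intro hj; simpa using hj
    | cons j J hj hJ ih =>
      intro H
      obtain ⟨Z, ⟨hv, hu, hc⟩, hZJ⟩ := ih fun i hi => H i (by simp [hi])
      obtain ⟨Z', ⟨hv', hu', hc'⟩, hj'⟩ := H j (by simp)
      have h1 := cut_inter_union Z Z' M
      have h2 := h.cut_ge (Z ∪ Z') (by simp [hv, hv']) ⟨u, by simp [hu], (hdeg p).2⟩
      refine ⟨Z ∩ Z', ⟨by simp [hv], by simp [hu, hu'], by omega⟩, fun i hi => ?_⟩
      rcases Finset.mem_cons.1 hi with rfl | hi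
      · simp [hj']
      · simp [hZJ i hi]
  have hall₃ : ∀ J : Finset ι, J.Nonempty →
      (∀ j ∈ J, ∃ s, P₃ s ∧ act (a j) (s (x j)) ≠ -act (a p) 1) →
      ∃ s, P₃ s ∧ ∀ j ∈ J, act (a j) (s (x j)) ≠ -act (a p) 1 := by
    intro J hJ
    induction hJ using Finset.Nonempty.cons_induction with
    | singleton j => intro hj; simpa using hj
    | cons j J hj hJ ih =>
      intro H
      obtain ⟨s, ⟨hv, hu, hc⟩, hsJ⟩ := ih fun i hi => H i (by simp [hi])
      obtain ⟨t, ⟨hv', hu', hc'⟩, hj'⟩ := H j (by simp)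
      have h1 := cost_meet_join s t M
      have hju : join (s u) (t u) = -act (a p) 1 := by
        rw [hu, hu']; rcases hε with h | h <;> rw [h] <;> decide
      have hmu : meet (s u) (t u) = -act (a p) 1 := by rw [hu, hu']; simp [meet]
      have h2 := hs (fun x => join (s x) (t x)) (by simp only [hv, hv']; decide)
        ⟨u, huv, (hdeg p).2, by
          simp only [hju]; rcases hε with h | h <;> rw [h] <;> decide⟩
      have hmeet : ∀ q r ε : SignType, (ε = 1 ∨ ε = -1) → (q ≠ -ε ∨ r ≠ -ε) →
        meet q r ≠ -ε := by decide
      refine ⟨fun x => meet (s x) (t x), ⟨by simp only [hv, hv']; decide, hmu, by omega⟩,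
        fun i hi => ?_⟩
      rw [act_meet]
      rcases Finset.mem_cons.1 hi with rfl | hi
      · exact hmeet _ _ _ hε (.inr hj')
      · exact hmeet _ _ _ hε (.inl (hsJ i hi))
  let B₂ : Finset ι := {j | ∃ Z, P₂ Z ∧ x j ∉ Z}
  let B₃ : Finset ι := {j | ∃ s, P₃ s ∧ act (a j) (s (x j)) = act (a p) 1}
  have hcover : ∀ j, j ∈ B₂ ∨ (x j = v ∧ a j = a p) ∨ j ∈ B₃ := by
    intro j
    by_cases hj : p = j
    · subst hj; exact .inr (.inl ⟨hp, rfl⟩)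
    · rcases hbad j hj with ⟨Z, h1, h2, h3, h4⟩ | h1 | ⟨s, h1, h2, h3, h4⟩
      · exact .inl ((Finset.mem_filter_univ _).2 ⟨Z, ⟨h1, h2, h3⟩, h4⟩)
      · exact .inr (.inl h1)
      · exact .inr (.inr ((Finset.mem_filter_univ _).2 ⟨s, ⟨h1, h2, h3⟩, h4⟩))
  have hεne : act (a p) 1 ≠ -act (a p) 1 := by
    rcases hε with h | h <;> rw [h] <;> decide
  rcases B₃.eq_empty_or_nonempty with hB₃ | hB₃
  · exfalso
    rw [hB₃] at hcover
    rcases B₂.eq_empty_or_nonempty with hB₂ | hB₂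
    · rw [hB₂] at hcover
      replace hcover : ∀ j, x j = v ∧ a j = a p := by simpa using hcover
      have h1 := h.cost_le
      have h2 := h.cost_ge (Function.update (ind {v}) u (act (a p) 1)) (by simp [huv.symm, ind])
      have hRR : wt (cost (Function.update (ind {v}) u (act (a p) 1))) R =
          wt (cost (ind {v})) R := by
        refine cost_congr fun y hy => ?_
        have : y ≠ u := by rintro rfl; omega
        simp [this]
      have hg : ∀ a, gap 0 (act a 1) = 1 := by decide
      have hg' : ∀ p, gap p p = 0 := by decide
      rw [star_cost hM] at h1
      rw [star_cost hM, hRR] at h2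
      simp [hcover, ind, huv, hg, hι] at h1
      simp [hcover, ind, huv.symm, hg'] at h2
      omega
    · obtain ⟨Z, ⟨hv, hu, hc⟩, hZ⟩ := hall₂ B₂ hB₂ fun j hj => (Finset.mem_filter.1 hj).2
      have := card_cross_le_three h hM hxu hR hι hv hu hc (J := Finset.univ) (by
        intro j _
        rcases hcover j with h1 | h1 | h1
        · exact hZ j h1
        · rwa [h1.1]
        · simp at h1)
      rw [Finset.card_univ, hι] at this
      omega
  · obtain ⟨s, ⟨hsv, hsu, hsc⟩, hsB⟩ := hall₃ B₃ hB₃ fun j hj => by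
      obtain ⟨s, h1, h2⟩ := (Finset.mem_filter.1 hj).2
      exact ⟨s, h1, by rw [h2]; exact hεne⟩
    let T : Finset ι := {i | act (a i) (s (x i)) = -act (a p) 1}
    have hRR : wt (cost (Function.update s u 0)) R = wt (cost s) R := by
      refine cost_congr fun y hy => ?_
      have : y ≠ u := by rintro rfl; omega
      simp [this]
    -- Relabelling u by 0 adds one for each edge in T and saves at least one for each other edge at
    -- u. As s costs at most 8 and the result at least 6, T has at least two elements; the cut
    -- allows no more, so the result costs exactly 6 and is trivial.
    have hsum : wt (cost (Function.update s u 0)) M + 6 ≤ wt (cost s) M + 2 * T.card := by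
      rw [star_cost hM, star_cost hM, hRR]
      have : ∑ i, gap (Function.update s u 0 u) (act (a i) (Function.update s u 0 (x i))) + 6 ≤
          ∑ i, gap (s u) (act (a i) (s (x i))) + 2 * T.card := by
        rw [← hι, ← Finset.card_univ, Finset.card_eq_sum_ones, Finset.card_filter, Finset.mul_sum,
          ← Finset.sum_add_distrib, ← Finset.sum_add_distrib]
        refine Finset.sum_le_sum fun i _ => ?_
        have key : ∀ q ε : SignType, (ε = 1 ∨ ε = -1) →
          gap 0 q + 1 ≤ gap (-ε) q + 2 * (if q = -ε then 1 else 0) := by decide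
        simpa [hxu, hsu] using key (act (a i) (s (x i))) _ hε
      omega
    have h6 := h.cost_ge (Function.update s u 0) (by simp [huv.symm, hsv])
    have hTB : ∀ i ∈ T, i ∈ B₂ := by
      intro i hi
      have hi' : act (a i) (s (x i)) = -act (a p) 1 := (Finset.mem_filter.1 hi).2
      rcases hcover i with h1 | h1 | h1
      · exact h1
      · rw [h1.1, h1.2, hsv] at hi'
        exact absurd hi' hεne
      · exact absurd hi' (hsB i h1)
    have hTne : T.Nonempty := by rw [← Finset.card_pos]; omega
    obtain ⟨Z, ⟨hv, hu, hc⟩, hZ⟩ := hall₂ T hTne fun j hj =>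
      (Finset.mem_filter.1 (hTB j hj)).2
    refine ⟨⟨Z, hv, hu, hc⟩, ?_⟩
    have hpT : p ∉ T := by
      intro hpT
      have := (Finset.mem_filter.1 hpT).2
      rw [hp, hsv] at this
      exact hεne this
    have h3 := card_cross_le_three h hM hxu hR hι hv hu hc (J := insert p T) (by
      intro j hj
      rcases Finset.mem_insert.1 hj with rfl | hj
      · rwa [hp]
      · exact hZ j hj)
    rw [Finset.card_insert_of_notMem hpT] at h3
    have hT2 : T.card = 2 := by omega
    refine Eq.trans (congrArg Finset.card ?_) hT2
    ext i
    simp only [T, Finset.mem_filter_univ]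
    constructor
    · rintro ⟨h1, h2⟩
      rw [h1, hsv]
      exact (by decide : ∀ a b, a ≠ b → act a 1 = -act b 1) _ _ h2
    · intro h1
      have hne : s (x i) ≠ 0 := by
        intro h0
        rw [h0, act_self_zero] at h1
        rcases hε with h | h <;> rw [h] at h1 <;> exact absurd h1 (by decide)
      have hxv : x i = v := by
        by_contra hxv
        have := hs (Function.update s u 0) (by simp [huv.symm, hsv])
          ⟨x i, hxv, (hdeg i).1, by simpa [hxu] using hne⟩
        omega
      refine ⟨hxv, fun h2 => ?_⟩
      rw [hxv, hsv, h2] at h1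
      exact hεne h1

/-- Counting from p and from an opposite edge q yields two edges to v of each sign. All four leave
the cut Z, which admits only three. -/
theorem exists_red_of_deg_six (h : IsRooted v M) (hs : IsStrict v M)
    (hM : M = Finset.univ.val.map (fun i => (s(u, x i), a i)) + R) (hxu : ∀ i, x i ≠ u)
    (hR : wt (deg u) R = 0) (huv : u ≠ v) (hι : Fintype.card ι = 6) {p : ι} (hp : x p = v) :
    ∃ N, Red {v} M N ∧ IsRooted v N ∧ wt (deg u) N < wt (deg u) M := by
  by_contra hcon
  obtain ⟨⟨Z, hv, hu, hc⟩, h2⟩ := card_opposite_eq_two h hs hM hxu hR huv hι hp hcon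
  obtain ⟨q, hq⟩ : (Finset.univ.filter fun i => x i = v ∧ a i ≠ a p).Nonempty := by
    rw [← Finset.card_pos]; omega
  have hq' := (Finset.mem_filter.1 hq).2
  obtain ⟨-, h3⟩ := card_opposite_eq_two h hs hM hxu hR huv hι hq'.1 hcon
  have h4 := card_cross_le_three h hM hxu hR hι hv hu hc
    (J := (Finset.univ.filter fun i => x i = v ∧ a i ≠ a p) ∪
      (Finset.univ.filter fun i => x i = v ∧ a i ≠ a q)) (by
    intro j hj
    have : x j = v := by
      rcases Finset.mem_union.1 hj with h | h <;> exact ((Finset.mem_filter.1 h).2).1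
    rwa [this])
  rw [Finset.card_union_of_disjoint, h2, h3] at h4
  · omega
  · rw [Finset.disjoint_left]
    intro i hi hi'
    exact hq'.2 ((by decide : ∀ a b c : ZMod 2, a ≠ b → a ≠ c → c = b) _ _ _
      (Finset.mem_filter.1 hi).2.2 (Finset.mem_filter.1 hi').2.2)

end star

/-! ### Contraction of tight sets and the induction -/

theorem wt_deg_emap [Fintype V] (π : V → V') (y : V') (M : Multiset (SEdge V)) :
    wt (deg y) (M.map (emap π)) = ∑ x with π x = y, wt (deg x) M := by
  induction M using Multiset.induction_on with
  | empty => simp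
  | cons e M ih =>
    obtain ⟨e, a⟩ := e
    induction e with | _ p q
    simp [ih, Finset.sum_add_distrib]

theorem wt_cost_emap (π : V → V') (s : V' → SignType) (M : Multiset (SEdge V)) :
    wt (cost s) (M.map (emap π)) = wt (cost (s ∘ π)) M := by
  rw [wt_map]
  refine wt_congr fun ⟨e, a⟩ _ => ?_
  induction e with | _ p q
  rfl

theorem wt_cut_emap [Fintype V] (π : V → V') (Z : Finset V') (M : Multiset (SEdge V)) :
    wt (cut Z) (M.map (emap π)) = wt (cut {x | π x ∈ Z}) M := by
  rw [wt_map]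
  refine wt_congr fun ⟨e, a⟩ _ => ?_
  induction e with | _ p q
  simp

theorem wt_sign_emap (π : V → V') (M : Multiset (SEdge V)) :
    wt Prod.snd (M.map (emap π)) = wt Prod.snd M := by
  rw [wt_map]; rfl

/-- The contraction of `U` to the vertex `v`. -/
def contr (U : Finset V) (v x : V) : V := if x ∈ U then v else x

theorem contr_of_mem {U : Finset V} {v x : V} (hx : x ∈ U) : contr U v x = v := if_pos hx

theorem contr_of_notMem {U : Finset V} {v x : V} (hx : x ∉ U) : contr U v x = x := if_neg hx

theorem contr_eq_iff {U : Finset V} {v x : V} (hv : v ∈ U) : contr U v x = v ↔ x ∈ U := by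
  by_cases hx : x ∈ U
  · simp [hx, contr_of_mem]
  · simp only [contr_of_notMem hx, hx, iff_false]; rintro rfl; exact hx hv

theorem wt_deg_contr_of_mem [Fintype V] {U : Finset V} {v w : V} (M : Multiset (SEdge V))
    (hwv : w ≠ v) (hw : w ∈ U) : wt (deg w) (M.map (emap (contr U v))) = 0 := by
  rw [wt_deg_emap, Finset.filter_false_of_mem, Finset.sum_empty]
  intro x _ hx
  by_cases hxU : x ∈ U
  · exact hwv (hx.symm.trans (contr_of_mem hxU))
  · rw [contr_of_notMem hxU] at hx; exact hxU (hx ▸ hw)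

theorem wt_deg_contr_of_notMem [Fintype V] {U : Finset V} {v w : V} (hv : v ∈ U)
    (M : Multiset (SEdge V)) (hw : w ∉ U) :
    wt (deg w) (M.map (emap (contr U v))) = wt (deg w) M := by
  have : (Finset.univ.filter fun x => contr U v x = w) = {w} := by
    ext x
    simp only [Finset.mem_filter_univ, Finset.mem_singleton]
    constructor
    · intro hx
      by_cases hxU : x ∈ U
      · rw [contr_of_mem hxU] at hx; exact absurd (hx ▸ hv) hw
      · rwa [contr_of_notMem hxU] at hx
    · rintro rfl; exact contr_of_notMem hw
  rw [wt_deg_emap, this, Finset.sum_singleton]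

theorem Red.lift_contr {U : Finset V} {v : V} (hv : v ∈ U) {M N' : Multiset (SEdge V)}
    (H : Red {v} (M.map (emap (contr U v))) N') :
    ∃ N, Red U M N ∧ N.map (emap (contr U v)) = N' := by
  refine Red.lift _ (fun x y hx hxy => ?_) (fun x hx => ?_) H
  · have hxU : x ∉ U := by simpa [contr_eq_iff hv] using hx
    have hyU : y ∉ U := by rw [hxy] at hx; simpa [contr_eq_iff hv] using hx
    rwa [contr_of_notMem hxU, contr_of_notMem hyU] at hxy
  · simpa [contr_eq_iff hv] using hx

section
variable [Fintype V] {v : V} {M : Multiset (SEdge V)}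

/-- `M` can be reduced to loops at `v` of which at least three are odd. -/
def Reducible (v : V) (M : Multiset (SEdge V)) : Prop :=
  ∃ N, Red {v} M N ∧ (∀ w, w ≠ v → wt (deg w) N = 0) ∧ 6 ≤ wt (cost (ind {v})) N

/-- Induction applies to the contraction of U, and its splittings lift to splittings outside U that
leave all edges inside U. At most three of these are odd, so `red_to_root` finishes. -/
theorem reducible_of_tight_set (h : IsRooted v M) {U : Finset V} (hv : v ∈ U)
    (hU : ∃ w ∈ U, w ≠ v ∧ 0 < wt (deg w) M) (hc : wt (cost (ind U)) M ≤ 6)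
    (IH : ∀ M', IsRooted v M' → ∑ w ∈ Finset.univ.erase v, wt (deg w) M' <
      ∑ w ∈ Finset.univ.erase v, wt (deg w) M → Reducible v M') : Reducible v M := by
  set π := contr U v with hπdef
  have hπU : ∀ x, x ∈ U → π x = v := fun x hx => contr_of_mem hx
  have hπ : ∀ x, x ∉ U → π x = x := fun x hx => contr_of_notMem hx
  have hind : ind {v} ∘ π = ind U := by
    funext x; simp [ind, hπdef, contr_eq_iff hv]
  have hdegU : ∀ (N : Multiset (SEdge V)) w, w ≠ v → w ∈ U →
      wt (deg w) (N.map (emap π)) = 0 := fun N w => wt_deg_contr_of_mem N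
  have hdeg : ∀ (N : Multiset (SEdge V)) w, w ∉ U →
      wt (deg w) (N.map (emap π)) = wt (deg w) N := fun N w => wt_deg_contr_of_notMem hv N
  have hM' : IsRooted v (M.map (emap π)) := by
    refine ⟨fun w => ?_, fun w hw => ?_, fun s hs => ?_, ?_, fun Z hZ hw => ?_, ?_⟩
    · rw [wt_deg_emap]; exact Finset.even_sum _ fun x _ => h.even x
    · by_cases hwU : w ∈ U
      · rw [hdegU M w hw hwU]; omega
      · rw [hdeg M w hwU]; exact h.deg_le w hw
    · rw [wt_cost_emap]; exact h.cost_ge _ (by simp [hπU v hv, hs])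
    · rwa [wt_cost_emap, hind]
    · obtain ⟨w, hwZ, hw⟩ := hw
      rw [wt_cut_emap]
      have hwv : w ≠ v := by rintro rfl; exact hZ hwZ
      have hwU : w ∉ U := fun hwU => by rw [hdegU M w hwv hwU] at hw; omega
      rw [hdeg M w hwU] at hw
      exact h.cut_ge _ (by simp [hπU v hv, hZ]) ⟨w, by simp [hπ w hwU, hwZ], hw⟩
    · rw [wt_sign_emap]; exact h.odd
  obtain ⟨N', hred', hN', hcN'⟩ := IH _ hM' (by
    obtain ⟨w, hwU, hwv, hw⟩ := hU
    refine Finset.sum_lt_sum (fun x hx => ?_) ⟨w, by simp [hwv], ?_⟩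
    · by_cases hxU : x ∈ U
      · rw [hdegU M x (Finset.ne_of_mem_erase hx) hxU]; omega
      · rw [hdeg M x hxU]
    · rwa [hdegU M w hwv hwU])
  obtain ⟨N, hred, rfl⟩ := hred'.lift_contr hv
  have hNU : ∀ w, 0 < wt (deg w) N → w ∈ U := by
    intro w hw
    by_contra hwU
    have := hN' w (by rintro rfl; exact hwU hv)
    rw [hdeg N w hwU] at this
    omega
  rw [wt_cost_emap, hind] at hcN'
  obtain ⟨N₂, hred₂, h₂, hc₂⟩ := red_to_root v 3 N (fun w => hred.even_deg (h.even w)) (by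
    intro Z hvZ hZ w hwZ
    by_contra hw
    have hwU := hNU w (by omega)
    have h1 := h.cut_ge (Z ∩ U) (by simp [hvZ]) ⟨w, by simp [hwZ, hwU],
      lt_of_lt_of_le (by omega) (hred.deg_le w)⟩
    have h2 := h.cost_ge (ind (U \ Z)) (by simp [ind, hv, hvZ])
    -- Edges inside U survive the splitting, so none of them crosses Z. The boundary of U is then
    -- shared out, which would give 6 + 4 ≤ 6.
    have key : wt (cost (ind (U \ Z))) M + wt (cut (Z ∩ U)) M ≤ wt (cost (ind U)) M := by
      rw [← wt_fun_add]
      refine wt_le fun ⟨e, a⟩ he => ?_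
      induction e with | _ p q
      have hno : p ∈ U → q ∈ U → (p ∈ Z ↔ q ∈ Z) := by
        intro hp hq
        have hmem : (s(p, q), a) ∈ N := by
          have := Multiset.mem_of_le hred.filter_le (a := (s(p, q), a))
            (Multiset.mem_filter.2 ⟨he, by simp [hp, hq]⟩)
          exact (Multiset.mem_filter.1 this).1
        simpa using wt_eq_zero.1 hZ _ hmem
      have k0 : ∀ a, gap 1 (act a 0) = 1 := by decide
      have k1 : ∀ a, gap 0 (act a 1) = 1 := by decide
      have k2 : ∀ a, gap 0 (act a 0) = 0 := by decide
      by_cases hp : p ∈ U <;> by_cases hq : q ∈ U <;> by_cases hpZ : p ∈ Z <;>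
        by_cases hqZ : q ∈ Z <;> simp [ind, hp, hq, hpZ, hqZ, k0, k1, k2] at hno ⊢
    omega) (by
    intro W hW
    have e : wt (cost (ind W)) N = wt (cost (ind (W ∩ U))) N :=
      cost_congr fun x hx => by simp [ind, hNU x hx]
    -- The cost of `ind U` was at most 6 and is still at least 6, so the cost of the smaller
    -- indicator has not dropped either.
    have h1 := hred.cost_ind_le (W := W ∩ U) Finset.inter_subset_right
    have h2 := h.cost_ge (ind (W ∩ U)) (by simp [ind, hv, hW])
    omega) (by
    right
    have e : wt (cost (ind Finset.univ)) N = wt (cost (ind U)) N :=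
      cost_congr fun x hx => by simp [ind, hNU x hx]
    have h1 := hred.cost_le (ind U)
    omega)
  exact ⟨N₂, (hred.mono (by simpa using hv)).trans hred₂, h₂, hc₂⟩

theorem map_sw_map_sw (f : V → ZMod 2) (M : Multiset (SEdge V)) :
    (M.map (sw f)).map (sw f) = M := by
  rw [Multiset.map_map]
  conv_rhs => rw [← Multiset.map_id M]
  exact Multiset.map_congr rfl fun e _ => sw_sw f e

theorem wt_cost_sw (f : V → ZMod 2) (s : V → SignType) (M : Multiset (SEdge V)) :
    wt (cost s) (M.map (sw f)) = wt (cost fun x => act (f x) (s x)) M := by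
  rw [wt_map]; exact wt_congr fun e _ => cost_sw f s e

theorem wt_deg_sw (f : V → ZMod 2) (w : V) (M : Multiset (SEdge V)) :
    wt (deg w) (M.map (sw f)) = wt (deg w) M := by
  rw [wt_map]; rfl

theorem act_ind_singleton {f : V → ZMod 2} (hf : f v = 0) :
    (fun x => act (f x) (ind {v} x)) = ind {v} := by
  funext x
  by_cases hx : x = v
  · subst hx; simp [hf, act_zero]
  · simp [ind, hx, act_self_zero]

theorem IsRooted.switch (h : IsRooted v M) {f : V → ZMod 2} (hf : f v = 0) :
    IsRooted v (M.map (sw f)) where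
  even w := by rw [wt_deg_sw]; exact h.even w
  deg_le w hw := by rw [wt_deg_sw]; exact h.deg_le w hw
  cost_ge s hs := by rw [wt_cost_sw]; exact h.cost_ge _ (by simp [hf, hs, act_zero])
  cost_le := by rw [wt_cost_sw, act_ind_singleton hf]; exact h.cost_le
  cut_ge Z hZ hw := by
    simp only [wt_deg_sw] at hw
    rw [wt_map]
    exact h.cut_ge Z hZ hw
  odd := by rw [sign_sw f h.even]; exact h.odd

/-- Costs are even, so strictness fails at cost at most 6. Switching at the label -1 turns the
labelling into the indicator of its support, and it commutes with splitting. -/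
theorem reducible_of_not_isStrict (h : IsRooted v M) (hs : ¬ IsStrict v M)
    (IH : ∀ M', IsRooted v M' → ∑ w ∈ Finset.univ.erase v, wt (deg w) M' <
      ∑ w ∈ Finset.univ.erase v, wt (deg w) M → Reducible v M') : Reducible v M := by
  unfold IsStrict at hs
  push Not at hs
  obtain ⟨s, hsv, ⟨w, hwv, hw, hsw⟩, hc⟩ := hs
  obtain ⟨k, hk⟩ := even_cost s h.even
  let f : V → ZMod 2 := fun x => if s x = -1 then 1 else 0
  have hf : f v = 0 := by simp [f, hsv]
  have hfs : (fun x => act (f x) (ind {x | s x ≠ 0} x)) = s := by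
    funext x
    simp only [f, ind, Finset.mem_filter_univ]
    exact (by decide : ∀ p : SignType, act (if p = -1 then 1 else 0)
      (if p ≠ 0 then 1 else 0) = p) (s x)
  obtain ⟨N, hred, hN, hcN⟩ := reducible_of_tight_set (h.switch hf) (U := {x | s x ≠ 0})
    (by simp [hsv]) ⟨w, by simpa using hsw, hwv, by rwa [wt_deg_sw]⟩
    (by rw [wt_cost_sw, hfs]; omega) (by simpa only [wt_deg_sw] using IH)
  refine ⟨N.map (sw f), ?_, fun w hw => ?_, ?_⟩
  · have := hred.switch f
    rwa [map_sw_map_sw] at this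
  · rw [wt_deg_sw]; exact hN w hw
  · rwa [wt_cost_sw, act_ind_singleton hf]

theorem cut_singleton_le_deg (u : V) (e : SEdge V) : cut {u} e ≤ deg u e := by
  obtain ⟨e, a⟩ := e
  induction e with | _ p q
  by_cases hp : p = u <;> by_cases hq : q = u <;> simp [hp, hq]

/-- At least four non-loop edges and degree at most 6 leave three shapes at u: four edges, four
edges and a loop, or six edges. -/
theorem exists_red_of_isStrict (h : IsRooted v M) (hs : IsStrict v M)
    (hne : ∃ w, w ≠ v ∧ 0 < wt (deg w) M) :
    ∃ u, u ≠ v ∧ ∃ N, Red {v} M N ∧ IsRooted v N ∧ wt (deg u) N < wt (deg u) M := by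
  obtain ⟨w, hwv, hw⟩ := hne
  have h1 := h.cut_ge (Finset.univ.erase v) (by simp) ⟨w, by simp [hwv], hw⟩
  obtain ⟨u, α, hu, he, -⟩ := exists_edge_of_cut (v := v) (Z := Finset.univ.erase v) (by simp)
    (M := M) (by omega)
  have huv : u ≠ v := Finset.ne_of_mem_erase hu
  refine ⟨u, huv, ?_⟩
  rw [Sym2.eq_swap] at he
  have hcut := h.cut_ge {u} (by simp [huv.symm])
    ⟨u, by simp, lt_of_lt_of_le (by simp) (le_wt (deg u) he)⟩
  have heven := h.even u
  have hle := h.deg_le u huv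
  obtain ⟨M₁, rfl⟩ := Multiset.exists_cons_of_mem he
  have hfin : ∀ {n : ℕ} (x : Fin n → V) (a : Fin n → ZMod 2), (∀ i, x i ≠ u) →
      wt (cut {u}) (Finset.univ.val.map fun i => (s(u, x i), a i)) = n := by
    intro n x a hx
    rw [wt_univ]; simp [hx]
  have hcutR : ∀ {R : Multiset (SEdge V)}, wt (deg u) R = 0 → wt (cut {u}) R = 0 := by
    intro R hR
    have := wt_le (M := R) fun e _ => cut_singleton_le_deg u e
    omega
  by_cases hl : ∃ l, (s(u, u), l) ∈ M₁
  · obtain ⟨l, hl⟩ := hl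
    obtain ⟨M₂, rfl⟩ := Multiset.exists_cons_of_mem hl
    by_cases hl₂ : ∃ l, (s(u, u), l) ∈ M₂
    · obtain ⟨l₂, hl₂⟩ := hl₂
      obtain ⟨M₃, rfl⟩ := Multiset.exists_cons_of_mem hl₂
      have := wt_le (M := M₃) fun e _ => cut_singleton_le_deg u e
      simp [huv.symm] at hcut hle
      omega
    · push Not at hl₂
      obtain ⟨n, x, a, R, rfl, hx, hR, hn⟩ := exists_star hl₂
      simp only [wt_cons, wt_add, hfin x a hx, hcutR hR] at hcut
      simp only [wt_cons, hn] at hle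
      simp [huv.symm] at hcut hle
      obtain rfl : n = 3 := by omega
      refine exists_red_of_loop h hs (α := α) (x := x 0) (y := x 1) (z := x 2) (a := a 0)
        (b := a 1) (c := a 2) (l := l) (R := R) ?_ hR huv (hx 0) (hx 1) (hx 2)
      rw [Fin.univ_val_map]
      simp only [List.ofFn_succ, List.ofFn_zero, ← Multiset.cons_coe, Multiset.cons_add,
        Multiset.coe_nil, zero_add]
      rw [Multiset.cons_swap (s(u, u), l), Multiset.cons_swap (s(u, u), l),
        Multiset.cons_swap (s(u, u), l)]
      rfl
  · push Not at hl
    obtain ⟨n, x, a, R, rfl, hx, hR, hn⟩ := exists_star hl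
    have hdeg : wt (deg u) ((s(u, v), α) ::ₘ (Finset.univ.val.map (fun i => (s(u, x i), a i)) + R))
        = n + 1 := by rw [wt_cons, hn]; simp [huv.symm]; omega
    simp only [wt_cons, wt_add, hfin x a hx, hcutR hR] at hcut
    simp [huv.symm] at hcut
    rw [hdeg] at hle heven
    obtain ⟨k, hk⟩ := heven
    obtain rfl | rfl : n = 3 ∨ n = 5 := by omega
    · refine exists_red_of_deg_four h hs (α := α) (x := x 0) (y := x 1) (z := x 2) (a := a 0)
        (b := a 1) (c := a 2) (R := R) ?_ hR huv (hx 0) (hx 1) (hx 2)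
      rw [Fin.univ_val_map]
      simp only [List.ofFn_succ, List.ofFn_zero, ← Multiset.cons_coe, Multiset.cons_add,
        Multiset.coe_nil, zero_add]
      rfl
    · refine exists_red_of_deg_six h hs (ι := Option (Fin 5)) (x := fun i => i.elim v x)
        (a := fun i => i.elim α a) (R := R) (p := none) ?_ ?_ hR huv (by simp) rfl
      · change _ = (Finset.univ.val.map _) + R
        rw [univ_option]
        simp [Finset.insertNone, -Fin.univ_val_map]
        rfl
      · rintro (_ | i)
        · exact huv.symm
        · exact hx i

theorem IsRooted.reducible (h : IsRooted v M) : Reducible v M := by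
  induction hm : ∑ w ∈ Finset.univ.erase v, wt (deg w) M using Nat.strong_induction_on
    generalizing M with
  | _ m ih
  subst hm
  by_cases hs : IsStrict v M
  · by_cases hne : ∃ w, w ≠ v ∧ 0 < wt (deg w) M
    · obtain ⟨u, huv, N, hred, hN, hd⟩ := exists_red_of_isStrict h hs hne
      obtain ⟨N', hred', h'⟩ := ih _ (sum_deg_lt huv hred.deg_le hd) hN rfl
      exact ⟨N', hred.trans hred', h'⟩
    · push Not at hne
      exact ⟨M, .refl, fun w hw => by have := hne w hw; omega, h.cost_ge _ (by simp [ind])⟩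
  · exact reducible_of_not_isStrict h hs fun M' hM' hlt => ih _ hlt hM' rfl

end

/-! ### Six-regular graphs: two-edge cuts and the choice of the root -/

section
variable [Fintype V] {M : Multiset (SEdge V)}

theorem sum_deg_eq (W : Finset V) (M : Multiset (SEdge V)) :
    ∑ w ∈ W, wt (deg w) M = 2 * (M.filter fun e => e.1 ∈ W.sym2).card + wt (cut W) M := by
  induction M using Multiset.induction_on with
  | empty => simp
  | cons e M ih =>
    obtain ⟨e, a⟩ := e
    induction e with | _ p q
    by_cases hp : p ∈ W <;> by_cases hq : q ∈ W <;>
      simp [Finset.sum_add_distrib, ih, hp, hq] <;> omega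

/-- The vertices of positive degree. -/
def verts (M : Multiset (SEdge V)) : Finset V := {w | 0 < wt (deg w) M}

theorem mem_verts {w : V} : w ∈ verts M ↔ 0 < wt (deg w) M := by simp [verts]

/-- Connected graphs, all of whose edges are odd, with an odd number of vertices, each of
degree six. Vertices of degree zero are ignored. -/
structure IsOddSixRegular (M : Multiset (SEdge V)) : Prop where
  sign : ∀ e ∈ M, e.2 = 1
  deg : ∀ w ∈ verts M, wt (deg w) M = 6
  conn : ∀ Z, wt (cut Z) M = 0 → (∀ w ∈ Z, w ∉ verts M) ∨ (∀ w ∈ verts M, w ∈ Z)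
  odd : Odd (verts M).card

theorem IsOddSixRegular.sum_deg (h : IsOddSixRegular M) (W : Finset V) :
    ∑ w ∈ W, wt (SignedGraph.deg w) M = 6 * (W ∩ verts M).card := by
  rw [← Finset.sum_subset Finset.inter_subset_left, Finset.sum_const_nat (m := 6), mul_comm]
  · intro x hx; exact h.deg x (Finset.mem_inter.1 hx).2
  · intro x hx hx'
    have : x ∉ verts M := fun h => hx' (Finset.mem_inter.2 ⟨hx, h⟩)
    rw [mem_verts] at this; omega

theorem IsOddSixRegular.even (h : IsOddSixRegular M) (w : V) :
    Even (wt (SignedGraph.deg w) M) := by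
  by_cases hw : w ∈ verts M
  · rw [h.deg w hw]; decide
  · rw [mem_verts] at hw
    rw [show wt (SignedGraph.deg w) M = 0 by omega]; exact .zero

theorem sign_of_all_odd (h : ∀ e ∈ M, e.2 = 1) : wt Prod.snd M = (M.card : ZMod 2) := by
  rw [wt_congr (g := fun _ => 1) h]
  simp [wt]

theorem IsOddSixRegular.sign_eq (h : IsOddSixRegular M) : wt Prod.snd M = 1 := by
  rw [sign_of_all_odd h.sign, ZMod.natCast_eq_one_iff_odd]
  have h1 := sum_deg_eq Finset.univ M
  rw [h.sum_deg, Finset.univ_inter] at h1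
  have h2 : wt (cut Finset.univ) M = 0 := by
    rw [wt_eq_zero]
    rintro ⟨e, a⟩ -
    induction e with | _ p q
    simp
  have h3 : M.filter (fun e => e.1 ∈ (Finset.univ : Finset V).sym2) = M := by simp
  rw [h2, h3] at h1
  obtain ⟨k, hk⟩ := h.odd
  exact ⟨3 * k + 1, by omega⟩

theorem wt_cut_compl (Z : Finset V) (M : Multiset (SEdge V)) : wt (cut Zᶜ) M = wt (cut Z) M := by
  refine wt_congr fun ⟨e, a⟩ _ => ?_
  induction e with | _ p q
  simp [not_iff_not]

/-- Splitting outside W turns the far side into a single edge inside W. The number of original edges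
inside W is 3|W| - 1, counting vertices of positive degree; this is even, so the new edge must be
odd to keep the total sign. -/
theorem exists_red_of_two_cut (h : IsOddSixRegular M) {W : Finset V} (hW : wt (cut W) M = 2)
    (hodd : Odd (W ∩ verts M).card) :
    ∃ N, Red W M N ∧ IsOddSixRegular N ∧ verts N = W ∩ verts M ∧ verts N ≠ verts M := by
  obtain ⟨v, hv⟩ : (W ∩ verts M).Nonempty := by
    rw [← Finset.card_pos]; exact hodd.pos
  rw [Finset.mem_inter] at hv
  obtain ⟨y, hy, hyW⟩ : ∃ y ∈ verts M, y ∉ W := by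
    by_contra! hcon
    have h1 := sum_deg_eq Wᶜ M
    have h2 : Wᶜ ∩ verts M = ∅ := by
      ext w
      simp only [Finset.mem_inter, Finset.mem_compl, Finset.notMem_empty, iff_false, not_and]
      exact fun hw hwM => hw (hcon w hwM)
    rw [h.sum_deg, h2, wt_cut_compl, hW, Finset.card_empty] at h1
    omega
  obtain ⟨N', hred', hN', -⟩ := red_to_root v 0 (M.map (emap (contr W v)))
    (fun w => by rw [wt_deg_emap]; exact Finset.even_sum _ fun x _ => h.even x) (by
      intro Z hvZ hZ w hwZ
      rw [wt_cut_emap] at hZ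
      have hwv : w ≠ v := by rintro rfl; exact hvZ hwZ
      by_cases hwW : w ∈ W
      · exact wt_deg_contr_of_mem M hwv hwW
      · rw [wt_deg_contr_of_notMem hv.1 M hwW]
        rcases h.conn _ hZ with h1 | h1
        · have := h1 w (by simp [contr_of_notMem hwW, hwZ])
          rw [mem_verts] at this; omega
        · have := h1 v hv.2
          simp [contr_of_mem hv.1, hvZ] at this) (by simp) (.inl rfl)
  obtain ⟨N, hred, rfl⟩ := hred'.lift_contr hv.1
  have hNW : ∀ w, w ∉ W → wt (deg w) N = 0 := by
    intro w hw
    rw [← wt_deg_contr_of_notMem hv.1 N hw]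
    exact hN' w (by rintro rfl; exact hw hv.1)
  have hdegN : ∀ w ∈ W, wt (deg w) N = wt (deg w) M := fun w hw => hred.deg_eq hw
  have hverts : verts N = W ∩ verts M := by
    ext w
    rw [Finset.mem_inter, mem_verts, mem_verts]
    by_cases hw : w ∈ W
    · simp [hw, hdegN w hw]
    · simp [hw, hNW w hw]
  have hfilter : N.filter (fun e => e.1 ∈ W.sym2) = N := by
    rw [Multiset.filter_eq_self]
    rintro ⟨e, a⟩ he
    induction e with | _ p q
    have hp : p ∈ W := by
      by_contra hp
      have := le_wt (deg p) he
      rw [hNW p hp] at this; simp at this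
    have hq : q ∈ W := by
      by_contra hq
      have := le_wt (deg q) he
      rw [hNW q hq] at this; simp at this
    simp [hp, hq]
  have hcutN : wt (cut W) N = 0 := by
    rw [wt_eq_zero, ← hfilter]
    rintro ⟨e, a⟩ he
    have := (Multiset.mem_filter.1 he).2
    induction e with | _ p q
    simp at this
    simp [this]
  have hle := hred.filter_le
  rw [hfilter] at hle
  obtain ⟨X, hX⟩ := Multiset.le_iff_exists_add.1 hle
  have h1 := sum_deg_eq W M
  have h2 := sum_deg_eq W N
  rw [Finset.sum_congr rfl hdegN, h1, hcutN, hW, hfilter] at h2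
  have hXc : X.card = 1 := by
    have := congrArg Multiset.card hX
    rw [Multiset.card_add] at this
    omega
  obtain ⟨⟨e₀, a₀⟩, rfl⟩ := Multiset.card_eq_one.1 hXc
  have hs := hred.sign_eq
  rw [h.sign_eq, hX, wt_add, sign_of_all_odd fun e he => h.sign e (Multiset.mem_filter.1 he).1,
    (ZMod.natCast_eq_zero_iff_even (n := Multiset.card _)).2] at hs
  · have ha₀ : a₀ = 1 := by simpa [wt] using hs
    refine ⟨N, hred, ⟨?_, ?_, ?_, ?_⟩, hverts, ?_⟩
    · intro e he
      rw [hX, Multiset.mem_add] at he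
      rcases he with he | he
      · exact h.sign e (Multiset.mem_filter.1 he).1
      · rw [Multiset.mem_singleton.1 he]; exact ha₀
    · intro w hw
      rw [hverts, Finset.mem_inter] at hw
      rw [hdegN w hw.1]; exact h.deg w hw.2
    · intro Y hY
      -- The two boundary edges of W are shared between two even cuts, so one of these is empty.
      have key : wt (cut (Y ∩ W)) M + wt (cut (Y ∪ Wᶜ)) M ≤ wt (cut W) M := by
        rw [← wt_fun_add]
        refine wt_le fun ⟨e, a⟩ he => ?_
        induction e with | _ p q
        have hno : p ∈ W → q ∈ W → (p ∈ Y ↔ q ∈ Y) := by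
          intro hp hq
          have hmem : (s(p, q), a) ∈ N :=
            Multiset.mem_of_le hle (Multiset.mem_filter.2 ⟨he, by simp [hp, hq]⟩)
          simpa using wt_eq_zero.1 hY _ hmem
        by_cases hp : p ∈ W <;> by_cases hq : q ∈ W <;> by_cases hpY : p ∈ Y <;>
          by_cases hqY : q ∈ Y <;> simp [hp, hq, hpY, hqY] at hno ⊢
      obtain ⟨i, hi⟩ := even_cut (Y ∩ W) h.even
      obtain ⟨j, hj⟩ := even_cut (Y ∪ Wᶜ) h.even
      rw [hverts]
      simp only [Finset.mem_inter]
      obtain h0 | h0 : wt (cut (Y ∩ W)) M = 0 ∨ wt (cut (Y ∪ Wᶜ)) M = 0 := by omega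
      · refine (h.conn _ h0).imp (fun hh w hw hw' => hh w (by simp [hw, hw'.1]) hw'.2)
          fun hh w hw => ?_
        have := hh w hw.2
        simp at this; exact this.1
      · refine (h.conn _ h0).imp (fun hh w hw hw' => hh w (by simp [hw]) hw'.2)
          fun hh w hw => ?_
        have := hh w hw.2
        simpa [hw.1] using this
    · rw [hverts]; exact hodd
    · intro heq
      rw [← heq, hverts, Finset.mem_inter] at hy
      exact hyW hy.1
  · rw [h.sum_deg] at h1
    obtain ⟨k, hk⟩ := hodd
    exact ⟨_, (by omega : _ = (3 * k + 1) + (3 * k + 1))⟩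

/-- On odd edges the cost is |s x + s y|, and summing s x + s y over all edges gives 6 ∑ s. Hence |6
∑ s| < 6. -/
theorem IsOddSixRegular.sum_eq_zero (h : IsOddSixRegular M) {s : V → SignType}
    (hs : wt (cost s) M < 6) : ∑ w ∈ verts M, (s w : ℤ) = 0 := by
  have h1 := wt_lift_eq_sum (fun x => (s x : ℤ)) M
  have h2 : ∀ N : Multiset (SEdge V), (∀ e ∈ N, e.2 = 1) →
      |wt (fun e : SEdge V =>
        Sym2.lift ⟨fun x y => (s x : ℤ) + s y, fun _ _ => add_comm _ _⟩ e.1) N| ≤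
      wt (cost s) N := by
    intro N hN
    induction N using Multiset.induction_on with
    | empty => simp
    | cons e N ih =>
      have h1 := hN e (by simp)
      have h2 := ih fun e he => hN e (by simp [he])
      obtain ⟨e, a⟩ := e
      induction e with | _ p q
      obtain rfl : a = 1 := h1
      rw [wt_cons, wt_cons]
      refine (abs_add_le _ _).trans ?_
      push_cast
      refine add_le_add ?_ h2
      exact (by decide : ∀ p q : SignType, |(p : ℤ) + q| ≤ (gap p (act 1 q) : ℤ)) _ _
  have h3 : ∑ w, ((wt (SignedGraph.deg w) M : ℕ) : ℤ) * (s w : ℤ) = 6 * ∑ w ∈ verts M, (s w : ℤ) := by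
    rw [← Finset.sum_subset (Finset.subset_univ (verts M)), Finset.mul_sum]
    · refine Finset.sum_congr rfl fun w hw => ?_
      rw [h.deg w hw]; rfl
    · intro w _ hw
      rw [mem_verts] at hw
      rw [show wt (SignedGraph.deg w) M = 0 by omega]; simp
  have h4 := h2 M h.sign
  rw [h1, h3, abs_le] at h4
  omega

/-- Overlapping supports are uncrossed by `gap_rem`: one of the two erased labellings still costs
less than 6. Disjoint supports of even size cannot cover an odd number of vertices. -/
theorem IsOddSixRegular.not_cover (h : IsOddSixRegular M) (F : V → V → SignType)
    (hF : ∀ i, wt (cost (F i)) M < 6) : ¬ ∀ w ∈ verts M, ∃ i, F i w ≠ 0 := by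
  induction hm : ∑ i, (Finset.univ.filter fun x => F i x ≠ 0).card using Nat.strong_induction_on
    generalizing F with
  | _ m ih
  subst hm
  intro hcov
  have heven : ∀ s : V → SignType, Even (wt (cost s) M) := fun s => even_cost s h.even
  by_cases hdisj : ∃ i j x, i ≠ j ∧ F i x ≠ 0 ∧ F j x ≠ 0
  · obtain ⟨i, j, x, hij, hi, hj⟩ := hdisj
    obtain ⟨r, hr, hrx⟩ : ∃ r : SignType, r ≠ 0 ∧ F i x = r * F j x :=
      (by decide : ∀ p q : SignType, p ≠ 0 → q ≠ 0 → ∃ r, r ≠ 0 ∧ p = r * q) _ _ hi hj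
    have hrx' : F j x = r * F i x :=
      (by decide : ∀ r p q : SignType, r ≠ 0 → p = r * q → q = r * p) _ _ _ hr hrx
    have hpos : wt (cost fun x => rem r (F i x) (F j x)) M +
        wt (cost fun x => rem r (F j x) (F i x)) M ≤ wt (cost (F i)) M + wt (cost (F j)) M := by
      rw [← wt_fun_add, ← wt_fun_add]
      refine wt_le fun ⟨e, a⟩ _ => ?_
      induction e with | _ p q
      exact gap_rem r a _ _ _ _ hr
    -- Where a label of `F i` is erased, `F j` is nonzero, so the cover persists, while the support
    -- shrinks at x.
    have main : ∀ i j, i ≠ j → F i x ≠ 0 → F i x = r * F j x →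
        ¬ wt (cost fun x => rem r (F i x) (F j x)) M < 6 := by
      intro i j hij hi hrx hlt
      refine ih _ ?_ (Function.update F i fun x => rem r (F i x) (F j x)) ?_ rfl ?_
      · refine Finset.sum_lt_sum (fun k _ => Finset.card_le_card fun y => ?_)
          ⟨i, Finset.mem_univ _, Finset.card_lt_card ?_⟩
        · by_cases hk : k = i
          · subst hk
            simp only [Function.update_self, Finset.mem_filter_univ, rem]
            split_ifs <;> simp
          · simp [Function.update_of_ne hk]
        · rw [Finset.ssubset_iff_of_subset]
          · exact ⟨x, by simpa using hi, by simp [rem, hrx]⟩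
          · intro y
            simp only [Function.update_self, Finset.mem_filter_univ, rem]
            split_ifs <;> simp
      · intro k
        by_cases hk : k = i
        · subst hk; simpa using hlt
        · simpa [Function.update_of_ne hk] using hF k
      · intro w hw
        obtain ⟨k, hk⟩ := hcov w hw
        by_cases hki : k = i
        · subst hki
          by_cases hrem : F k w = r * F j w
          · refine ⟨j, ?_⟩
            rw [Function.update_of_ne hij.symm]
            intro h0
            rw [h0, mul_zero] at hrem
            exact hk hrem
          · exact ⟨k, by simpa [rem, hrem] using hk⟩
        · exact ⟨k, by rwa [Function.update_of_ne hki]⟩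
    have h1 := main i j hij hi hrx
    have h2 := main j i hij.symm hj hrx'
    obtain ⟨a, ha⟩ := heven (F i)
    obtain ⟨b, hb⟩ := heven (F j)
    have h3 := hF i
    have h4 := hF j
    omega
  · push Not at hdisj
    have hcard : (verts M).card = ∑ i, ((verts M).filter fun w => F i w ≠ 0).card := by
      simp only [Finset.card_filter]
      rw [Finset.sum_comm, Finset.card_eq_sum_ones]
      refine Finset.sum_congr rfl fun w hw => ?_
      obtain ⟨i, hi⟩ := hcov w hw
      rw [Finset.sum_eq_single i]
      · simp [hi]
      · intro j _ hj
        have := hdisj i j w hj.symm hi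
        simp [this]
      · simp
    have : Even (verts M).card := by
      rw [hcard]
      refine Finset.even_sum _ fun i _ => ?_
      have h1 := h.sum_eq_zero (hF i)
      rw [← ZMod.natCast_eq_zero_iff_even, Finset.card_filter]
      have h2 := congrArg (Int.cast : ℤ → ZMod 2) h1
      push_cast at h2 ⊢
      refine Eq.trans ?_ h2
      refine Finset.sum_congr rfl fun w _ => ?_
      exact (by decide : ∀ p : SignType, (if p ≠ 0 then 1 else 0 : ZMod 2) = (p : ZMod 2)) _
    exact (Nat.not_even_iff_odd.2 h.odd) this

theorem IsOddSixRegular.exists_isRooted (h : IsOddSixRegular M)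
    (hcut : ∀ Z, wt (cut Z) M ≠ 2) : ∃ v ∈ verts M, IsRooted v M := by
  obtain ⟨v, hv, hcost⟩ : ∃ v ∈ verts M, ∀ s : V → SignType, s v = 1 → 6 ≤ wt (cost s) M := by
    by_contra! hcon
    choose! F hF hFc using hcon
    refine h.not_cover (fun v => if v ∈ verts M then F v else 0) (fun i => ?_) fun w hw =>
      ⟨w, by simp [hw, hF w hw]⟩
    by_cases hi : i ∈ verts M
    · simpa [hi] using hFc i hi
    · have : wt (cost (0 : V → SignType)) M = 0 := by
        rw [wt_eq_zero]
        rintro ⟨e, a⟩ -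
        induction e with | _ p q
        exact (by decide : ∀ a : ZMod 2, gap 0 (act a 0) = 0) a
      simp [hi, this]
  refine ⟨v, hv, h.even, fun w _ => ?_, hcost, ?_, fun Z hvZ hw => ?_, h.sign_eq⟩
  · by_cases hw : w ∈ verts M
    · exact (h.deg w hw).le
    · rw [mem_verts] at hw; omega
  · rw [← h.deg v hv]
    refine wt_le fun ⟨e, a⟩ _ => ?_
    induction e with | _ p q
    have k := (by decide : ∀ (a : ZMod 2) (b c : Bool), gap (if b then 1 else 0)
      (act a (if c then 1 else 0)) ≤ (if b then 1 else 0) + (if c then 1 else 0)) a (p = v) (q = v)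
    simpa [ind] using k
  · obtain ⟨k, hk⟩ := even_cut Z h.even
    have h2 := hcut Z
    by_contra hlt
    obtain ⟨w, hwZ, hw⟩ := hw
    rcases h.conn Z (by omega) with h1 | h1
    · exact h1 w hwZ (mem_verts.2 hw)
    · exact hvZ (h1 v hv)

/-- One side of a two-edge cut has an odd number of vertices. A root found there is untouched by the
splitting on the other side. -/
theorem IsOddSixRegular.exists_reducible (h : IsOddSixRegular M) :
    ∃ v ∈ verts M, Reducible v M := by
  induction hm : (verts M).card using Nat.strong_induction_on generalizing M with
  | _ m ih
  subst hm
  by_cases hcut : ∃ Z, wt (cut Z) M = 2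
  · obtain ⟨W, hW, hodd⟩ : ∃ W, wt (cut W) M = 2 ∧ Odd (W ∩ verts M).card := by
      obtain ⟨Z, hZ⟩ := hcut
      by_cases hodd : Odd (Z ∩ verts M).card
      · exact ⟨Z, hZ, hodd⟩
      · refine ⟨Zᶜ, by rwa [wt_cut_compl], ?_⟩
        rw [Nat.not_odd_iff_even] at hodd
        have h1 := Finset.card_inter_add_card_sdiff (verts M) Z
        have h2 : Zᶜ ∩ verts M = verts M \ Z := by ext; simp [and_comm]
        rw [Finset.inter_comm] at h1
        have h3 := h.odd
        rw [← h1, Nat.odd_add'] at h3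
        rw [h2]; exact h3.2 hodd
    obtain ⟨N, hred, hN, hv, hne⟩ := exists_red_of_two_cut h hW hodd
    have hsub : verts N ⊆ verts M := by rw [hv]; exact Finset.inter_subset_right
    obtain ⟨v, hvN, N', hred', h'⟩ := ih _ (Finset.card_lt_card (hsub.ssubset_of_ne hne)) hN rfl
    rw [hv, Finset.mem_inter] at hvN
    exact ⟨v, hvN.2, N', (hred.mono (by simpa using hvN.1)).trans hred', h'⟩
  · push Not at hcut
    obtain ⟨v, hv, hR⟩ := h.exists_isRooted hcut
    exact ⟨v, hv, hR.reducible⟩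

end
end SignedGraph

/-! ### From signed edges back to closed trails -/

namespace Graph
open SignedGraph
variable {α β : Type*} {G : Graph α β}

theorem IsWalkOn.left_mem {u w : α} {l : List (β × α)} (h : G.IsWalkOn u l w) : u ∈ V(G) := by
  cases l with
  | nil => exact h.1
  | cons t l => exact h.1.left_mem

theorem IsWalkOn.append {u v w : α} {l l' : List (β × α)} (h : G.IsWalkOn u l v)
    (h' : G.IsWalkOn v l' w) : G.IsWalkOn u (l ++ l') w := by
  induction l generalizing u with
  | nil => obtain ⟨-, rfl⟩ := h; exact h'
  | cons t l ih => exact ⟨h.1, ih h.2⟩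

theorem IsWalkOn.exists_reverse {u w : α} {l : List (β × α)} (h : G.IsWalkOn u l w) :
    ∃ l', G.IsWalkOn w l' u ∧ l'.length = l.length ∧
      (l'.map Prod.fst : Multiset β) = (l.map Prod.fst : Multiset β) := by
  induction l generalizing u with
  | nil => obtain ⟨hu, rfl⟩ := h; exact ⟨[], ⟨hu, rfl⟩, rfl, rfl⟩
  | cons t l ih =>
    obtain ⟨l', h1, h2, h3⟩ := ih h.2
    refine ⟨l' ++ [(t.1, u)], h1.append ⟨h.1.symm, h.1.left_mem, rfl⟩, by simp [h2], ?_⟩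
    rw [List.map_append, ← Multiset.coe_add, h3, add_comm]
    simp

/-- The ends and the parity of the length of a walk. -/
def walkEdge (t : V(G) × List (β × α) × V(G)) : SEdge V(G) :=
  (s(t.1, t.2.2), (t.2.1.length : ZMod 2))

/-- The signed edges of `M` are represented by walks that together use the edges in `F`. -/
def IsRealizedBy (M : Multiset (SEdge V(G))) (F : Multiset β) : Prop :=
  ∃ T : Multiset (V(G) × List (β × α) × V(G)), T.map walkEdge = M ∧
    (∀ t ∈ T, G.IsWalkOn t.1 t.2.1 t.2.2) ∧
    (T.map fun t => (t.2.1.map Prod.fst : Multiset β)).sum = F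

theorem exists_walk_of_walkEdge {x y : V(G)} {a : ZMod 2} {t : V(G) × List (β × α) × V(G)}
    (ht : G.IsWalkOn t.1 t.2.1 t.2.2) (h : walkEdge t = (s(x, y), a)) :
    ∃ l, G.IsWalkOn x.1 l y.1 ∧ (l.length : ZMod 2) = a ∧
      (l.map Prod.fst : Multiset β) = (t.2.1.map Prod.fst : Multiset β) := by
  obtain ⟨p, l, q⟩ := t
  simp only [walkEdge, Prod.mk.injEq, Sym2.eq_iff] at h
  obtain ⟨⟨rfl, rfl⟩ | ⟨rfl, rfl⟩, rfl⟩ := h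
  · exact ⟨l, ht, rfl, rfl⟩
  · obtain ⟨l', h1, h2, h3⟩ := ht.exists_reverse
    exact ⟨l', h1, by rw [h2], h3⟩

theorem _root_.Multiset.exists_cons_of_map_eq_cons {γ δ : Type*} {f : γ → δ} {T : Multiset γ}
    {d : δ} {R : Multiset δ} (h : T.map f = d ::ₘ R) :
    ∃ t T', T = t ::ₘ T' ∧ f t = d ∧ T'.map f = R := by
  obtain ⟨t, ht, rfl⟩ := Multiset.mem_map.1 (h ▸ Multiset.mem_cons_self d R)
  obtain ⟨T', rfl⟩ := Multiset.exists_cons_of_mem ht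
  exact ⟨t, T', rfl, rfl, (Multiset.cons_inj_right _).1 (by rw [← h, Multiset.map_cons])⟩

/-- Splitting off concatenates two walks, after reversal where needed, and keeps the multiset of
edges used. -/
theorem IsRealizedBy.step {S : Finset V(G)} {M N : Multiset (SEdge V(G))} {F : Multiset β}
    (h : IsRealizedBy M F) (H : Step S M N) : IsRealizedBy N F := by
  obtain ⟨u, x, y, a, b, R, -, rfl, rfl⟩ := H
  obtain ⟨T, hT, hw, hF⟩ := h
  obtain ⟨t₁, T, rfl, ht₁, hT⟩ := Multiset.exists_cons_of_map_eq_cons hT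
  obtain ⟨t₂, T, rfl, ht₂, rfl⟩ := Multiset.exists_cons_of_map_eq_cons hT
  obtain ⟨l₁, h1, rfl, e1⟩ := exists_walk_of_walkEdge (hw t₁ (by simp)) ht₁
  obtain ⟨l₂, h2, rfl, e2⟩ := exists_walk_of_walkEdge (hw t₂ (by simp)) ht₂
  refine ⟨(x, l₁ ++ l₂, y) ::ₘ T, by simp [walkEdge], ?_, ?_⟩
  · intro t ht
    rcases Multiset.mem_cons.1 ht with rfl | ht
    · exact h1.append h2
    · exact hw t (by simp [ht])
  · rw [← hF]
    simp only [Multiset.map_cons, Multiset.sum_cons, List.map_append, ← Multiset.coe_add, e1, e2,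
      add_assoc]

theorem IsRealizedBy.red {S : Finset V(G)} {M N : Multiset (SEdge V(G))} {F : Multiset β}
    (h : IsRealizedBy M F) (H : Red S M N) : IsRealizedBy N F := by
  induction H with
  | refl => exact h
  | tail _ H ih => exact ih.step H

theorem IsWalkOn.edge_mem {u w : α} {l : List (β × α)} (h : G.IsWalkOn u l w) {e : β}
    (he : e ∈ l.map Prod.fst) : ∃ x y, x ∈ u :: l.map Prod.snd ∧ y ∈ u :: l.map Prod.snd ∧
      G.IsLink e x y := by
  induction l generalizing u with
  | nil => simp at he
  | cons t l ih =>
    rw [List.map_cons, List.mem_cons] at he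
    rcases he with rfl | he
    · exact ⟨u, t.2, by simp, by simp, h.1⟩
    · obtain ⟨x, y, hx, hy, hl⟩ := ih h.2 he
      exact ⟨x, y, List.mem_cons_of_mem _ hx, List.mem_cons_of_mem _ hy, hl⟩

theorem IsWalkOn.mem_of_isLink {u w : α} {l : List (β × α)} (h : G.IsWalkOn u l w) {e : β}
    (he : e ∈ l.map Prod.fst) {x y : α} (hl : G.IsLink e x y) : x ∈ u :: l.map Prod.snd := by
  obtain ⟨p, q, hp, hq, hpq⟩ := h.edge_mem he
  rcases hl.left_eq_or_eq hpq with rfl | rfl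
  · exact hp
  · exact hq

theorem IsWalkOn.vertex_mem {u w : α} {l : List (β × α)} (h : G.IsWalkOn u l w) {x : α}
    (hx : x ∈ u :: l.map Prod.snd) : x ∈ V(G) := by
  induction l generalizing u with
  | nil => rw [List.map_nil, List.mem_singleton] at hx; exact hx ▸ h.1
  | cons t l ih =>
    rcases List.mem_cons.1 hx with rfl | hx
    · exact h.left_mem
    · exact ih h.2 hx

/-- The subgraph formed by the vertices and edges of a walk. -/
def walkSubgraph {u w : α} {l : List (β × α)} (h : G.IsWalkOn u l w) : Graph α β where
  vertexSet := {x | x ∈ u :: l.map Prod.snd}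
  edgeSet := {e | e ∈ l.map Prod.fst}
  IsLink e x y := e ∈ l.map Prod.fst ∧ G.IsLink e x y
  isLink_symm _ _ := ⟨fun _ _ h => ⟨h.1, h.2.symm⟩⟩
  eq_or_eq_of_isLink_of_isLink _ _ _ _ _ h h' := h.2.left_eq_or_eq h'.2
  edge_mem_iff_exists_isLink e := by
    refine ⟨fun he => ?_, fun ⟨_, _, he⟩ => he.1⟩
    obtain ⟨x, y, -, -, hl⟩ := h.edge_mem he
    exact ⟨x, y, he, hl⟩
  left_mem_of_isLink _ _ _ hl := h.mem_of_isLink hl.1 hl.2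

theorem walkSubgraph_le {u w : α} {l : List (β × α)} (h : G.IsWalkOn u l w) :
    walkSubgraph h ≤ G where
  vertexSet_mono _ hx := h.vertex_mem hx
  isLink_mono _ _ _ hl := hl.2

theorem isOddClosedTrail_walkSubgraph {u : α} {l : List (β × α)} (h : G.IsWalkOn u l u)
    (hl : (l.map Prod.fst).Nodup) (hodd : Odd l.length) : (walkSubgraph h).IsOddClosedTrail := by
  have key : ∀ (l' : List (β × α)) (x y : α), G.IsWalkOn x l' y → l' ⊆ l →
      x ∈ u :: l.map Prod.snd → (walkSubgraph h).IsWalkOn x l' y := by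
    intro l' x y hl' hsub hx
    induction l' generalizing x with
    | nil => exact ⟨hx, hl'.2⟩
    | cons t l' ih =>
      have ht : t ∈ l := hsub (by simp)
      exact ⟨⟨List.mem_map_of_mem ht, hl'.1⟩, ih _ hl'.2 (fun _ hs => hsub (by simp [hs]))
        (List.mem_cons_of_mem _ (List.mem_map_of_mem ht))⟩
  exact ⟨u, l, ⟨key l u u h (List.Subset.refl l) (by simp), hl⟩, hodd, fun _ => Iff.rfl,
    fun _ => Iff.rfl⟩

section multigraph
variable [Fintype V(G)] [Fintype E(G)] [DecidableEq V(G)]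

theorem exists_ends (e : E(G)) : ∃ p : V(G) × V(G), G.IsLink e.1 p.1 p.2 := by
  obtain ⟨x, y, h⟩ := exists_isLink_of_mem_edgeSet e.2
  exact ⟨(⟨x, h.left_mem⟩, ⟨y, h.right_mem⟩), h⟩

/-- The ends of an edge. -/
noncomputable def endPair (e : E(G)) : V(G) × V(G) := (exists_ends e).choose

theorem isLink_endPair (e : E(G)) : G.IsLink e.1 (endPair e).1 (endPair e).2 :=
  (exists_ends e).choose_spec

variable (G) in
/-- The edges of a graph, all of them odd. -/
noncomputable def oddEdges : Multiset (SEdge V(G)) :=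
  (Finset.univ : Finset E(G)).val.map fun e => (s((endPair e).1, (endPair e).2), 1)

theorem isRealizedBy_oddEdges :
    IsRealizedBy (oddEdges G) ((Finset.univ : Finset E(G)).val.map Subtype.val) := by
  refine ⟨(Finset.univ : Finset E(G)).val.map fun e =>
    ((endPair e).1, [(e.1, ((endPair e).2 : α))], (endPair e).2), ?_, ?_, ?_⟩
  · rw [Multiset.map_map]; simp [oddEdges, walkEdge, Function.comp_def]
  · intro t ht
    obtain ⟨e, -, rfl⟩ := Multiset.mem_map.1 ht
    exact ⟨isLink_endPair e, (endPair e).2.2, rfl⟩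
  · rw [Multiset.map_map, ← Multiset.sum_map_singleton (Multiset.map Subtype.val _),
      Multiset.map_map]
    rfl

theorem wt_deg_oddEdges (w : V(G)) : wt (deg w) (oddEdges G) = G.loopDegree w := by
  classical
  have h1 : {e | G.IsNonloopAt e w} = Subtype.val '' (↑(Finset.univ.filter fun e : E(G) =>
      G.IsNonloopAt e.1 w) : Set E(G)) := by
    ext e
    simp only [Set.mem_ofPred_eq, Finset.coe_filter, Finset.mem_univ, true_and, Set.mem_image]
    exact ⟨fun h => ⟨⟨e, h.edge_mem⟩, h, rfl⟩, fun ⟨e', h, he⟩ => he ▸ h⟩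
  have h2 : {e | G.IsLoopAt e w} = Subtype.val '' (↑(Finset.univ.filter fun e : E(G) =>
      G.IsLoopAt e.1 w) : Set E(G)) := by
    ext e
    simp only [Set.mem_ofPred_eq, Finset.coe_filter, Finset.mem_univ, true_and, Set.mem_image]
    exact ⟨fun h => ⟨⟨e, h.edge_mem⟩, h, rfl⟩, fun ⟨e', h, he⟩ => he ▸ h⟩
  rw [loopDegree, h1, h2, Set.ncard_image_of_injective _ Subtype.val_injective,
    Set.ncard_image_of_injective _ Subtype.val_injective, Set.ncard_coe_finset,
    Set.ncard_coe_finset, oddEdges, wt_univ, Finset.card_filter, Finset.card_filter,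
    Finset.mul_sum, ← Finset.sum_add_distrib]
  refine Finset.sum_congr rfl fun e _ => ?_
  have he := isLink_endPair e
  rw [deg_mk]
  generalize endPair e = p at *
  obtain ⟨p, q⟩ := p
  simp only at he ⊢
  have hl : G.IsLoopAt e w ↔ p = w ∧ q = w := by
    constructor
    · intro h
      have h1 := he.left_eq_or_eq h
      have h2 := he.right_eq_or_eq h
      exact ⟨Subtype.ext (h1.elim id id), Subtype.ext (h2.elim id id)⟩
    · rintro ⟨rfl, rfl⟩; exact he
  have hn : G.IsNonloopAt e w ↔ (p = w ∧ q ≠ w) ∨ (p ≠ w ∧ q = w) := by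
    constructor
    · rintro ⟨y, hy, h⟩
      rcases he.eq_and_eq_or_eq_and_eq h with ⟨h1, h2⟩ | ⟨h1, h2⟩
      · exact .inl ⟨Subtype.ext h1, fun h => hy (by rw [← h2, h])⟩
      · exact .inr ⟨fun h => hy (by rw [← h1, h]), Subtype.ext h2⟩
    · rintro (⟨rfl, h⟩ | ⟨h, rfl⟩)
      · exact ⟨q, fun h' => h (Subtype.ext h'), he⟩
      · exact ⟨p, fun h' => h (Subtype.ext h'), he.symm⟩
  rw [if_congr hl rfl rfl, if_congr hn rfl rfl]
  by_cases hp : p = w <;> by_cases hq : q = w <;> simp [hp, hq]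

theorem isOddSixRegular_oddEdges (hconn : G.IsConn) (hreg : G.IsRegularOfDeg 6)
    (hodd : Odd V(G).ncard) : IsOddSixRegular (oddEdges G) := by
  have hdeg : ∀ w : V(G), wt (deg w) (oddEdges G) = 6 := fun w => by
    rw [wt_deg_oddEdges]; exact hreg w w.2
  have hverts : verts (oddEdges G) = Finset.univ := by
    ext w; simp [mem_verts, hdeg]
  refine ⟨fun e he => ?_, fun w _ => hdeg w, fun Z hZ => ?_, ?_⟩
  · obtain ⟨e, -, rfl⟩ := Multiset.mem_map.1 he; rfl
  · have hlink : ∀ (x y : V(G)) e, G.IsLink e x y → (x ∈ Z ↔ y ∈ Z) := by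
      intro x y e h
      have h0 := wt_eq_zero.1 hZ _ (Multiset.mem_map_of_mem _
        (Finset.mem_univ_val (⟨e, h.edge_mem⟩ : E(G))))
      have h1 : (endPair ⟨e, h.edge_mem⟩).1 ∈ Z ↔ (endPair ⟨e, h.edge_mem⟩).2 ∈ Z := by
        simpa using h0
      rcases (isLink_endPair ⟨e, h.edge_mem⟩).eq_and_eq_or_eq_and_eq h with ⟨h2, h3⟩ | ⟨h2, h3⟩
      · rwa [Subtype.ext h2, Subtype.ext h3] at h1
      · rw [Subtype.ext h2, Subtype.ext h3] at h1; exact h1.symm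
    have hwalk : ∀ (l : List (β × α)) (x y : V(G)), G.IsWalkOn x l y → (x ∈ Z ↔ y ∈ Z) := by
      intro l
      induction l with
      | nil => intro x y h; rw [Subtype.ext h.2]
      | cons t l ih =>
        intro x y h
        exact (hlink x ⟨t.2, h.1.right_mem⟩ t.1 h.1).trans (ih ⟨t.2, h.1.right_mem⟩ y h.2)
    by_cases hne : ∃ x, x ∈ Z
    · obtain ⟨x, hx⟩ := hne
      refine .inr fun y _ => ?_
      obtain ⟨l, hl⟩ := hconn.2 x x.2 y y.2
      exact (hwalk l x y hl).1 hx
    · exact .inl fun w hw => absurd ⟨w, hw⟩ hne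
  · rw [hverts, Finset.card_univ, ← Nat.card_eq_fintype_card]
    exact hodd

end multigraph

theorem exists_isRootedOddDecomposition (hV : V(G).Finite) (hE : E(G).Finite)
    (hconn : G.IsConn) (hreg : G.IsRegularOfDeg 6) (hodd : Odd V(G).ncard) :
    ∃ (v : α) (H : Fin 3 → Graph α β), G.IsRootedOddDecomposition H v := by
  classical
  have := hV.fintype
  have := hE.fintype
  have hM := isOddSixRegular_oddEdges hconn hreg hodd
  obtain ⟨v, hv, N, hred, hN, hcost⟩ := hM.exists_reducible
  have hdeg : wt (deg v) N = 6 := (hred.deg_eq (by simp)).trans (hM.deg v hv)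
  obtain ⟨T, rfl, hw, hT⟩ := isRealizedBy_oddEdges.red hred
  have hloop : ∀ t ∈ T, ∃ a, walkEdge t = (s(v, v), a) := by
    intro t ht
    have hmem := Multiset.mem_map_of_mem walkEdge ht
    have hends : ∀ w ∈ (walkEdge t).1, w = v := by
      intro w hw
      by_contra hwv
      have h0 := wt_eq_zero.1 (hN w hwv) _ hmem
      generalize walkEdge t = e at hw h0
      obtain ⟨e, a⟩ := e
      induction e with | _ p q
      rcases Sym2.mem_iff.1 hw with rfl | rfl <;> simp at h0
    refine ⟨(walkEdge t).2, Prod.ext ?_ rfl⟩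
    exact Sym2.ext fun w => ⟨fun h => by simp [hends w h], fun h => by
      obtain rfl : w = v := by simpa using h
      have h1 := Sym2.out_fst_mem (walkEdge t).1
      rwa [hends _ h1] at h1⟩
  -- The degree 6 of v is unchanged and each loop uses 2 of it.
  have hcard : T.card = 3 := by
    have h1 : wt (deg v) (T.map walkEdge) = wt (fun _ => 2) T := by
      rw [wt_map]
      refine wt_congr fun t ht => ?_
      obtain ⟨a, ha⟩ := hloop t ht
      simp [ha]
    rw [hdeg] at h1
    simp [wt] at h1
    omega
  obtain ⟨t, rfl⟩ : ∃ t : Fin 3 → _, T = Finset.univ.val.map t := by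
    obtain ⟨t₀, t₁, t₂, rfl⟩ := Multiset.card_eq_three.1 hcard
    exact ⟨![t₀, t₁, t₂], rfl⟩
  have hmem : ∀ i, t i ∈ Finset.univ.val.map t := fun i =>
    Multiset.mem_map_of_mem _ (Finset.mem_univ_val i)
  choose a ha using fun i => hloop (t i) (hmem i)
  -- An odd loop costs 2 and an even one 0, so three loops of total cost at least 6 are all odd.
  have hodd' : ∀ i, a i = 1 := by
    rw [wt_map, wt_univ] at hcost
    have hgap : ∀ a : ZMod 2, gap 1 (act a 1) = if a = 1 then 2 else 0 := by decide
    simp only [Function.comp_apply, ha, cost_mk, ind, Finset.mem_singleton, if_true, hgap,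
      Fin.sum_univ_three] at hcost
    intro i
    by_contra hi
    fin_cases i <;> simp only [Fin.zero_eta, Fin.mk_one, Fin.reduceFinMk] at hi <;>
      simp only [hi, if_false] at hcost <;> split_ifs at hcost <;> omega
  have hwalk : ∀ i, ∃ l, G.IsWalkOn v.1 l v.1 ∧ (l.length : ZMod 2) = a i ∧
      (l.map Prod.fst : Multiset β) = ((t i).2.1.map Prod.fst : Multiset β) := fun i =>
    exists_walk_of_walkEdge (hw (t i) (hmem i)) (ha i)
  choose l hl hlen hle using hwalk
  have hsum : ∑ i, ((l i).map Prod.fst : Multiset β) =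
      (Finset.univ : Finset E(G)).val.map Subtype.val := by
    rw [← hT, Multiset.map_map]
    exact Finset.sum_congr rfl fun i _ => hle i
  have hnodup : (∑ i, ((l i).map Prod.fst : Multiset β)).Nodup := by
    rw [hsum]; exact Finset.univ.nodup.map Subtype.val_injective
  refine ⟨v, fun i => walkSubgraph (hl i), fun i => walkSubgraph_le (hl i), fun i j hij => ?_, ?_,
    fun i => isOddClosedTrail_walkSubgraph (hl i) ?_ ?_, fun i => List.mem_cons_self⟩
  · refine Set.disjoint_left.2 fun e hi hj => ?_
    have h1 := Multiset.nodup_iff_count_le_one.1 hnodup e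
    rw [Multiset.count_sum'] at h1
    have h2 : ∑ k ∈ {i, j}, Multiset.count e ((l k).map Prod.fst : Multiset β) ≤ 1 :=
      (Finset.sum_le_sum_of_subset (Finset.subset_univ _)).trans h1
    rw [Finset.sum_pair hij] at h2
    have h3 := Multiset.one_le_count_iff_mem.2 (Multiset.mem_coe.2 hi)
    have h4 := Multiset.one_le_count_iff_mem.2 (Multiset.mem_coe.2 hj)
    omega
  · ext e
    have h1 : e ∈ ∑ i, ((l i).map Prod.fst : Multiset β) ↔ e ∈ E(G) := by
      rw [hsum]; simp
    rw [← h1, Multiset.mem_sum, Set.mem_iUnion]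
    simp [walkSubgraph]
  · exact Multiset.coe_nodup.1 (Multiset.nodup_of_le
      (Finset.single_le_sum (f := fun i => ((l i).map Prod.fst : Multiset β))
        (fun _ _ => Multiset.zero_le _) (Finset.mem_univ i)) hnodup)
  · rw [← ZMod.natCast_eq_one_iff_odd, hlen, hodd']

end Graph

theorem theorem2 {α β : Type*} (G : Graph α β) (hV : V(G).Finite) (hE : E(G).Finite)
    (hconn : G.IsConn) (hreg : G.IsRegularOfDeg 6) (hodd : Odd V(G).ncard) :
    ∃ (v : α) (H : Fin 3 → Graph α β), G.IsRootedOddDecomposition H v :=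
  Graph.exists_isRootedOddDecomposition hV hE hconn hreg hodd
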